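/- Theorem 1.1 (Counterexample). Let $d\ge 2$ and let $\Sigma\subset\mathbb R^d$ be a $C^2$ hypersurface, i.e. a set that near each of its points is the graph of a real-valued $C^2$ function over a hyperplane; $\Sigma$ need not be compact or closed. Let $\sigma$ be its surface measure. Assume that some connected component of $\Sigma$ is not contained in any affine hyperplane (for connected $\Sigma$: $\Sigma$ does not lie in a hyperplane). For $f\in L^1(\Sigma,d\sigma)$ put $$Ef(x)=\int_\Sigma e^{-2\pi i x\cdot\xi}f(\xi)\,d\sigma(\xi),\qquad x\in\mathbb R^d,$$ and for measurable $w:\mathbb R^d\to[0,\infty)$ put $\|Xw\|_\infty=\sup_{\ell}\int_\ell w$, the supremum over all lines $\ell\subset\mathbb R^d$. Then there is a constant $c>0$, depending only on $\Sigma$, such that for every $R\ge 1$ there are $f\in L^1(\Sigma,d\sigma)\cap L^2(\Sigma,d\sigma)$ with $\|f\|_2>0$ and a measurable weight $w:\mathbb R^d\to[0,\infty)$ with $0<\|Xw\|_\infty<\infty$ (both allowed to depend on $R$) such that $$\int_{B_R(0)}|Ef(x)|^2\,w(x)\,dx\ \ge\ c\,\log R\ \|f\|_{L^2(\Sigma,d\sigma)}^2\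 \sup_{\ell\subset\mathbb R^d\text{ a line}}\int_\ell w .$$ Consequently, for every such $\Sigma$, the Mizohata--Takeuchi conjecture fails: there is no finite constant $K$ such that $$\int_{\mathbb R^d}|Ef|^2\,w\,dx\le K\,\|f\|_{L^2(\Sigma,d\sigma)}^2\,\|Xw\|_\infty$$ for all $f\in L^1\cap L^2(\Sigma,d\sigma)$ and all measurable $w\ge 0$. Stein's conjecture fails as well: there is no finite constant $K$ such that $$\int_{\mathbb R^d}|Ef|^2\,w\,dx\le K\int_\Sigma|f(\xi)|^2\sup_{\ell\parallel N(\xi)}\Big(\int_\ell w\Big)\,d\sigma(\xi)$$ for all $f\in L^1\cap L^2(\Sigma,d\sigma)$ and all measurable $w\ge 0$, where $N(\xi)$ is the normal to $\Sigma$ at $\xi$. -/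

import Mathlib

open MeasureTheory
open scoped ENNReal NNReal

noncomputable section

namespace MizohataTakeuchi

/-- A set `S ⊆ ℝ^d` is an (embedded) `C²` hypersurface if near each of its points it is the graph,
over the hyperplane orthogonal to some unit vector `n`, of a real-valued `C²` function. Neither
compactness nor closedness is required. -/
def IsC2Hypersurface {d : ℕ} (S : Set (EuclideanSpace ℝ (Fin d))) : Prop :=
  ∀ p ∈ S, ∃ n : EuclideanSpace ℝ (Fin d), ‖n‖ = 1 ∧
    ∃ φ : (Submodule.span ℝ {n})ᗮ → ℝ, ContDiff ℝ 2 φ ∧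
      ∃ U : Set (EuclideanSpace ℝ (Fin d)), IsOpen U ∧ p ∈ U ∧
        ∀ x ∈ U, x ∈ S ↔
          inner ℝ n x = φ ((Submodule.span ℝ {n})ᗮ.orthogonalProjectionOnto x)

/-- The set `A` lies in some affine hyperplane of `ℝ^d`. -/
def LiesInHyperplane {d : ℕ} (A : Set (EuclideanSpace ℝ (Fin d))) : Prop :=
  ∃ v : EuclideanSpace ℝ (Fin d), v ≠ 0 ∧ ∃ a : ℝ, ∀ x ∈ A, inner ℝ v x = a

/-- Surface measure on `S`: the `(d-1)`-dimensional Hausdorff measure (in the Euclidean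
normalization) restricted to `S`, as a measure on `ℝ^d`. -/
def surfaceMeasure {d : ℕ} (S : Set (EuclideanSpace ℝ (Fin d))) :
    Measure (EuclideanSpace ℝ (Fin d)) :=
  (Measure.euclideanHausdorffMeasure (d - 1)).restrict S

/-- The Fourier extension operator `E f (x) = ∫_S e^{-2π i x·ξ} f(ξ) dσ(ξ)`. -/
def extension {d : ℕ} (S : Set (EuclideanSpace ℝ (Fin d))) (f : EuclideanSpace ℝ (Fin d) → ℂ)
    (x : EuclideanSpace ℝ (Fin d)) : ℂ :=
  ∫ ξ, Complex.exp (-2 * Real.pi * Complex.I * (inner ℝ x ξ : ℝ)) * f ξ ∂(surfaceMeasure S)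

/-- The squared norm `‖f‖²` in `L²(S, dσ)`. -/
def normSqL2 {d : ℕ} (S : Set (EuclideanSpace ℝ (Fin d)))
    (f : EuclideanSpace ℝ (Fin d) → ℂ) : ℝ≥0∞ :=
  ∫⁻ ξ, ‖f ξ‖ₑ ^ 2 ∂(surfaceMeasure S)

/-- The integral of `w` over the line through `x` with direction `v` (with respect to arc length
when `v` is a unit vector). -/
def lineIntegral {d : ℕ} (w : EuclideanSpace ℝ (Fin d) → ℝ≥0)
    (x v : EuclideanSpace ℝ (Fin d)) : ℝ≥0∞ :=
  ∫⁻ t : ℝ, (w (x + t • v) : ℝ≥0∞)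

/-- `‖X w‖_∞`, the supremum over all lines of the integral of `w` over the line. -/
def xraySup {d : ℕ} (w : EuclideanSpace ℝ (Fin d) → ℝ≥0) : ℝ≥0∞ :=
  ⨆ (x : EuclideanSpace ℝ (Fin d)) (v : EuclideanSpace ℝ (Fin d)) (_ : ‖v‖ = 1),
    lineIntegral w x v

/-- `v` is a unit normal to `S` at `ξ`. -/
def IsUnitNormal {d : ℕ} (S : Set (EuclideanSpace ℝ (Fin d)))
    (ξ v : EuclideanSpace ℝ (Fin d)) : Prop :=
  ‖v‖ = 1 ∧ ∀ u ∈ tangentConeAt ℝ S ξ, inner ℝ v u = 0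

/-- The supremum of the integral of `w` over all lines that are normal to `S` at `ξ` in direction,
that is, all lines parallel to the normal `N(ξ)`. -/
def xraySupNormal {d : ℕ} (S : Set (EuclideanSpace ℝ (Fin d)))
    (w : EuclideanSpace ℝ (Fin d) → ℝ≥0) (ξ : EuclideanSpace ℝ (Fin d)) : ℝ≥0∞ :=
  ⨆ (x : EuclideanSpace ℝ (Fin d)) (v : EuclideanSpace ℝ (Fin d)) (_ : IsUnitNormal S ξ v),
    lineIntegral w x v

/-- The global Mizohata–Takeuchi inequality for `S`, with some constant depending only on `S`. The
requirement `f ∈ L¹` makes `E f` meaningful; it is automatic when `S` has finite measure. -/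
def MizohataTakeuchiConjecture {d : ℕ} (S : Set (EuclideanSpace ℝ (Fin d))) : Prop :=
  ∃ K : ℝ≥0, ∀ (f : EuclideanSpace ℝ (Fin d) → ℂ) (w : EuclideanSpace ℝ (Fin d) → ℝ≥0),
    Integrable f (surfaceMeasure S) → MemLp f 2 (surfaceMeasure S) → Measurable w →
      ∫⁻ x, ‖extension S f x‖ₑ ^ 2 * (w x : ℝ≥0∞) ≤ (K : ℝ≥0∞) * normSqL2 S f * xraySup w

/-- Stein's inequality for `S`, with some constant depending only on `S`. -/
def SteinConjecture {d : ℕ} (S : Set (EuclideanSpace ℝ (Fin d))) : Prop :=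
  ∃ K : ℝ≥0, ∀ (f : EuclideanSpace ℝ (Fin d) → ℂ) (w : EuclideanSpace ℝ (Fin d) → ℝ≥0),
    Integrable f (surfaceMeasure S) → MemLp f 2 (surfaceMeasure S) → Measurable w →
      ∫⁻ x, ‖extension S f x‖ₑ ^ 2 * (w x : ℝ≥0∞) ≤
        (K : ℝ≥0∞) * ∫⁻ ξ, ‖f ξ‖ₑ ^ 2 * xraySupNormal S w ξ ∂(surfaceMeasure S)

end MizohataTakeuchi

end

/-! Let T be the union of the caps of radius ρ₁/R about N points q + η_j of the hypersurface, let f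
be the indicator of T, and let w be the Riesz product ∏ (1 + cos 2π⟨η_j, x⟩) cut off to B_R. At
scale R, |Ef|² is a sum of N² waves with frequencies close to η_i − η_j. Expanding the product shows
that w correlates with every one of them with coefficient at least 1/4, and positive definiteness
makes all other terms harmless. Hence ∫ |Ef|² w ≳ R^d σ(T)² (`riesz_lower_bound`). Since ‖f‖² = σ(T)
≳ N R^{-(d-1)}, this is ≳ N R ‖f‖².

It remains to keep the X-ray transform of w at O(R) while N grows like log R. On a line of direction
v, w is a one-dimensional Riesz product with frequencies ⟨η_j, v⟩. Its mean is bounded if these are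
lacunary, each exceeding the sum of the later ones by some δ with Rδ ≥ N
(`gaussianRieszCoeff_zero_le`). Every non-lacunary factor costs at most a factor 2, so boundedly
many exceptions per direction are affordable.

Curvature supplies such η_j. If the second derivative of a local graph vanished everywhere, every
component would lie in a hyperplane (`exists_curved`). Near a curved point, a curve in the
hypersurface has coordinates t, ≈ t², t³, …, t^d in a suitable frame, the second one being the
normal coordinate. At t_j = r L^{-j} each ⟨η_j, v⟩ combines d geometric sequences of different
rates. Two of them can be comparable at one index only, so a single one dominates outside at most d²
indices (`exists_lacunary_subset`). The gaps shrink like M^{-N}, so that Rδ ≥ N permits N ≈ log R.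
-/

open scoped Topology

namespace MizohataTakeuchi

/-! ### Positive definiteness of Riesz products and the lower bound -/

section Riesz

variable {ι E : Type*} [NormedAddCommGroup E] [InnerProductSpace ℝ E]

/-- The Riesz product `∏_{j ∈ J} (1 + cos (2π ⟪η j, x⟫))`. -/
noncomputable def rieszProduct (η : ι → E) (J : Finset ι) (x : E) : ℝ :=
  ∏ j ∈ J, (1 + Real.cos (2 * Real.pi * inner ℝ (η j) x))

lemma rieszProduct_nonneg (η : ι → E) (J : Finset ι) (x : E) : 0 ≤ rieszProduct η J x :=
  Finset.prod_nonneg fun j _ => by linarith [Real.neg_one_le_cos (2 * Real.pi * inner ℝ (η j) x)]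

lemma rieszProduct_le (η : ι → E) (J : Finset ι) (x : E) :
    rieszProduct η J x ≤ 2 ^ J.card := by
  rw [← Finset.prod_const]
  refine Finset.prod_le_prod (fun j _ => ?_) (fun j _ => ?_)
  · linarith [Real.neg_one_le_cos (2 * Real.pi * inner ℝ (η j) x)]
  · linarith [Real.cos_le_one (2 * Real.pi * inner ℝ (η j) x)]

lemma continuous_rieszProduct (η : ι → E) (J : Finset ι) : Continuous (rieszProduct η J) := by
  unfold rieszProduct
  fun_prop

lemma rieszProduct_zero (η : ι → E) (J : Finset ι) : rieszProduct η J 0 = 2 ^ J.card := by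
  simp [rieszProduct]; norm_num

variable [MeasurableSpace E] [BorelSpace E] [SecondCountableTopology E]

/-- The Fourier coefficient at `θ` of a Riesz product, averaged over the differences of two
points distributed according to `β`. -/
noncomputable def rieszCoeff (β : Measure E) (η : ι → E) (θ : E) (J : Finset ι) : ℝ :=
  ∫ p, Real.cos (2 * Real.pi * inner ℝ θ (p.1 - p.2)) * rieszProduct η J (p.1 - p.2) ∂(β.prod β)

variable (β : Measure E) [IsFiniteMeasure β] (η : ι → E)

lemma integrable_rieszCoeff (θ : E) (J : Finset ι) :
    Integrable (fun p : E × E => Real.cos (2 * Real.pi * inner ℝ θ (p.1 - p.2)) *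
      rieszProduct η J (p.1 - p.2)) (β.prod β) := by
  have hc : Continuous (fun p : E × E => Real.cos (2 * Real.pi * inner ℝ θ (p.1 - p.2)) *
      rieszProduct η J (p.1 - p.2)) := by
    have := continuous_rieszProduct η J
    fun_prop
  refine Integrable.of_bound hc.aestronglyMeasurable (2 ^ J.card) (ae_of_all _ fun p => ?_)
  rw [norm_mul, Real.norm_eq_abs, Real.norm_eq_abs, abs_of_nonneg (rieszProduct_nonneg _ _ _),
    ← one_mul ((2 : ℝ) ^ _)]
  exact mul_le_mul (Real.abs_cos_le_one _) (rieszProduct_le _ _ _)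
    (rieszProduct_nonneg _ _ _) zero_le_one

lemma rieszCoeff_insert [DecidableEq ι] (θ : E) {J : Finset ι} {a : ι} (ha : a ∉ J) :
    rieszCoeff β η θ (insert a J) = rieszCoeff β η θ J +
      (1 / 2) * rieszCoeff β η (θ + η a) J + (1 / 2) * rieszCoeff β η (θ - η a) J := by
  unfold rieszCoeff
  rw [← integral_const_mul, ← integral_const_mul, ← integral_add, ← integral_add]
  · congr 1
    ext p
    have h : rieszProduct η (insert a J) (p.1 - p.2) =
        (1 + Real.cos (2 * Real.pi * inner ℝ (η a) (p.1 - p.2))) *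
          rieszProduct η J (p.1 - p.2) := by
      simp only [rieszProduct]
      rw [Finset.prod_insert ha]
    rw [h, inner_add_left, inner_sub_left, mul_add, mul_sub, Real.cos_add, Real.cos_sub]
    ring
  · exact (integrable_rieszCoeff β η θ J).add ((integrable_rieszCoeff β η _ J).const_mul _)
  · exact (integrable_rieszCoeff β η _ J).const_mul _
  · exact integrable_rieszCoeff β η θ J
  · exact (integrable_rieszCoeff β η _ J).const_mul _

omit [SecondCountableTopology E] in
lemma integrable_cos_inner (ζ : E) :
    Integrable (fun y : E => Real.cos (2 * Real.pi * inner ℝ ζ y)) β := by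
  have : Continuous (fun y : E => Real.cos (2 * Real.pi * inner ℝ ζ y)) := by fun_prop
  exact Integrable.of_bound this.aestronglyMeasurable 1 (ae_of_all _ fun p => Real.abs_cos_le_one _)

omit [SecondCountableTopology E] in
lemma integrable_sin_inner (ζ : E) :
    Integrable (fun y : E => Real.sin (2 * Real.pi * inner ℝ ζ y)) β := by
  have : Continuous (fun y : E => Real.sin (2 * Real.pi * inner ℝ ζ y)) := by fun_prop
  exact Integrable.of_bound this.aestronglyMeasurable 1 (ae_of_all _ fun p => Real.abs_sin_le_one _)

lemma integral_prod_cos_sub (ζ : E) :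
    ∫ p, Real.cos (2 * Real.pi * inner ℝ ζ (p.1 - p.2)) ∂(β.prod β) =
      (∫ y, Real.cos (2 * Real.pi * inner ℝ ζ y) ∂β) ^ 2 +
      (∫ y, Real.sin (2 * Real.pi * inner ℝ ζ y) ∂β) ^ 2 := by
  rw [sq, sq, ← integral_prod_mul, ← integral_prod_mul, ← integral_add]
  · congr 1
    ext p
    rw [inner_sub_right, mul_sub, Real.cos_sub]
  · exact (integrable_cos_inner β ζ).mul_prod (integrable_cos_inner β ζ)
  · exact (integrable_sin_inner β ζ).mul_prod (integrable_sin_inner β ζ)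

lemma rieszCoeff_empty (ζ : E) :
    rieszCoeff β η ζ ∅ = (∫ y, Real.cos (2 * Real.pi * inner ℝ ζ y) ∂β) ^ 2 +
      (∫ y, Real.sin (2 * Real.pi * inner ℝ ζ y) ∂β) ^ 2 := by
  rw [← integral_prod_cos_sub]
  simp [rieszCoeff, rieszProduct]

/-- Averaging over differences makes the empty coefficient |β̂|², and each new factor only adds
translates with weights 1/2. This positivity is what allows unwanted terms of the expansion to be
dropped. -/
lemma rieszCoeff_nonneg (J : Finset ι) : ∀ θ : E, 0 ≤ rieszCoeff β η θ J := by
  classical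
  induction J using Finset.induction_on with
  | empty => intro θ; rw [rieszCoeff_empty]; positivity
  | insert a J ha ih =>
    intro θ
    rw [rieszCoeff_insert β η θ ha]
    linarith [ih θ, ih (θ + η a), ih (θ - η a)]

lemma rieszCoeff_mono (θ : E) {J K : Finset ι} (h : J ⊆ K) :
    rieszCoeff β η θ J ≤ rieszCoeff β η θ K := by
  classical
  rw [← Finset.union_sdiff_of_subset h]
  induction K \ J using Finset.induction_on with
  | empty => simp
  | insert a L ha ih =>
    refine ih.trans ?_
    rw [Finset.union_insert]
    by_cases ha' : a ∈ J ∪ L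
    · rw [Finset.insert_eq_of_mem ha']
    · rw [rieszCoeff_insert β η θ ha']
      linarith [rieszCoeff_nonneg β η (J ∪ L) (θ + η a), rieszCoeff_nonneg β η (J ∪ L) (θ - η a)]

/-- For i ≠ j, keep only the term taking +η i from one factor and −η j from another, each with
weight 1/2. For i = j the constant term already has coefficient 1. -/
lemma quarter_rieszCoeff_le (θ : E) {J : Finset ι} {i j : ι} (hi : i ∈ J) (hj : j ∈ J) :
    (1 / 4) * rieszCoeff β η (θ + η i - η j) ∅ ≤ rieszCoeff β η θ J := by
  classical
  by_cases hij : i = j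
  · subst hij
    rw [add_sub_cancel_right]
    linarith [rieszCoeff_mono β η θ (Finset.empty_subset J), rieszCoeff_nonneg β η ∅ θ]
  · have h1 : rieszCoeff β η θ {i, j} ≤ rieszCoeff β η θ J := by
      apply rieszCoeff_mono
      intro x hx
      rcases Finset.mem_insert.1 hx with h | h
      · exact h ▸ hi
      · exact Finset.mem_singleton.1 h ▸ hj
    have h2 := rieszCoeff_insert β η θ (J := {j}) (a := i) (by simpa using hij)
    have h3 := rieszCoeff_insert β η (θ + η i) (J := ∅) (a := j) (by simp)
    rw [insert_empty_eq] at h3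
    linarith [rieszCoeff_nonneg β η {j} θ, rieszCoeff_nonneg β η {j} (θ - η i),
      rieszCoeff_nonneg β η ∅ (θ + η i), rieszCoeff_nonneg β η ∅ (θ + η i + η j)]

end Riesz

section Lower

variable {ι E : Type*} [NormedAddCommGroup E] [InnerProductSpace ℝ E]
  [MeasurableSpace E] [BorelSpace E] [SecondCountableTopology E]

lemma rieszCoeff_empty_ge (β : Measure E) [IsFiniteMeasure β] (η : ι → E) (ζ : E)
    (h : ∀ᵐ y ∂β, |2 * Real.pi * inner ℝ ζ y| ≤ Real.pi / 3) :
    (1 / 4) * β.real Set.univ ^ 2 ≤ rieszCoeff β η ζ ∅ := by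
  rw [rieszCoeff_empty]
  have h1 : (1 / 2) * β.real Set.univ ≤ ∫ y, Real.cos (2 * Real.pi * inner ℝ ζ y) ∂β := by
    have : ∫ y, (1 / 2 : ℝ) ∂β ≤ ∫ y, Real.cos (2 * Real.pi * inner ℝ ζ y) ∂β := by
      refine integral_mono_ae (integrable_const _) (integrable_cos_inner β ζ) ?_
      filter_upwards [h] with y hy
      rw [← Real.cos_pi_div_three, ← Real.cos_abs (2 * Real.pi * inner ℝ ζ y)]
      exact Real.cos_le_cos_of_nonneg_of_le_pi (abs_nonneg _) (by linarith [Real.pi_pos]) hy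
    rw [integral_const, smul_eq_mul] at this
    linarith
  have h0 : 0 ≤ (1 / 2) * β.real Set.univ := by positivity
  nlinarith [sq_nonneg (∫ y, Real.sin (2 * Real.pi * inner ℝ ζ y) ∂β), pow_le_pow_left₀ h0 h1 2]

/-- The `L²` mass, against a Riesz product and over differences of points of `β`, of the
Fourier transform of a measure `μ` concentrated near translates of the frequencies. -/
lemma riesz_lower_bound (β μ : Measure E) [IsFiniteMeasure β] [IsFiniteMeasure μ] (η : ι → E)
    (J : Finset ι) (q : E) {ρ M : ℝ} (hρM : 2 * ρ * M ≤ 1 / 6)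
    (hβ : ∀ᵐ y ∂β, ‖y‖ ≤ M) (hμ : ∀ᵐ ξ ∂μ, ∃ j ∈ J, ‖ξ - (q + η j)‖ ≤ ρ) :
    (1 / 16) * β.real Set.univ ^ 2 * μ.real Set.univ ^ 2 ≤
      ∫ p : E × E, ((∫ ξ, Real.cos (2 * Real.pi * inner ℝ (p.1 - p.2) ξ) ∂μ) ^ 2 +
        (∫ ξ, Real.sin (2 * Real.pi * inner ℝ (p.1 - p.2) ξ) ∂μ) ^ 2) *
          rieszProduct η J (p.1 - p.2) ∂(β.prod β) := by
  have hc : Continuous (fun z : (E × E) × (E × E) =>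
      Real.cos (2 * Real.pi * inner ℝ (z.1.1 - z.1.2) (z.2.1 - z.2.2)) *
        rieszProduct η J (z.1.1 - z.1.2)) := by
    have := continuous_rieszProduct η J
    fun_prop
  have hint : Integrable (fun z : (E × E) × (E × E) =>
      Real.cos (2 * Real.pi * inner ℝ (z.1.1 - z.1.2) (z.2.1 - z.2.2)) *
        rieszProduct η J (z.1.1 - z.1.2)) ((β.prod β).prod (μ.prod μ)) := by
    refine Integrable.of_bound hc.aestronglyMeasurable (2 ^ J.card) (ae_of_all _ fun p => ?_)
    rw [norm_mul, Real.norm_eq_abs, Real.norm_eq_abs, abs_of_nonneg (rieszProduct_nonneg _ _ _),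
      ← one_mul ((2 : ℝ) ^ _)]
    exact mul_le_mul (Real.abs_cos_le_one _) (rieszProduct_le _ _ _)
      (rieszProduct_nonneg _ _ _) zero_le_one
  have h1 : ∀ p : E × E, ((∫ ξ, Real.cos (2 * Real.pi * inner ℝ (p.1 - p.2) ξ) ∂μ) ^ 2 +
        (∫ ξ, Real.sin (2 * Real.pi * inner ℝ (p.1 - p.2) ξ) ∂μ) ^ 2) *
          rieszProduct η J (p.1 - p.2) =
      ∫ z : E × E, Real.cos (2 * Real.pi * inner ℝ (p.1 - p.2) (z.1 - z.2)) *
        rieszProduct η J (p.1 - p.2) ∂(μ.prod μ) := fun p => by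
    rw [integral_mul_const, integral_prod_cos_sub]
  simp_rw [h1]
  rw [integral_integral_swap hint]
  have h2 : ∀ᵐ z ∂(μ.prod μ), (1 / 16) * β.real Set.univ ^ 2 ≤
      ∫ p : E × E, Real.cos (2 * Real.pi * inner ℝ (p.1 - p.2) (z.1 - z.2)) *
        rieszProduct η J (p.1 - p.2) ∂(β.prod β) := by
    have hm1 : ∀ᵐ z ∂(μ.prod μ), ∃ j ∈ J, ‖z.1 - (q + η j)‖ ≤ ρ :=
      Measure.quasiMeasurePreserving_fst.ae hμ
    have hm2 : ∀ᵐ z ∂(μ.prod μ), ∃ j ∈ J, ‖z.2 - (q + η j)‖ ≤ ρ :=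
      Measure.quasiMeasurePreserving_snd.ae hμ
    filter_upwards [hm1, hm2] with z ⟨i, hi, hi'⟩ ⟨j, hj, hj'⟩
    -- The roles of i and j are swapped: z.1 is near q + η i and z.2 near q + η j, so the shift η j
    -- − η i brings z.1 − z.2 within 2ρ of zero, and q cancels.
    have h3 := quarter_rieszCoeff_le β η (z.1 - z.2) hj hi
    have h4 := rieszCoeff_empty_ge β η (z.1 - z.2 + η j - η i) (by
      filter_upwards [hβ] with y hy
      have h5 : ‖z.1 - z.2 + η j - η i‖ ≤ 2 * ρ := by
        have : z.1 - z.2 + η j - η i = (z.1 - (q + η i)) - (z.2 - (q + η j)) := by abel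
        rw [this]
        linarith [norm_sub_le (z.1 - (q + η i)) (z.2 - (q + η j))]
      have h6 : |inner ℝ (z.1 - z.2 + η j - η i) y| ≤ 1 / 6 :=
        (abs_real_inner_le_norm _ _).trans
          ((mul_le_mul h5 hy (norm_nonneg _) ((norm_nonneg _).trans h5)).trans hρM)
      rw [abs_mul, abs_of_pos (by positivity)]
      nlinarith [Real.pi_pos])
    have h5 : rieszCoeff β η (z.1 - z.2) J =
      ∫ p : E × E, Real.cos (2 * Real.pi * inner ℝ (p.1 - p.2) (z.1 - z.2)) *
        rieszProduct η J (p.1 - p.2) ∂(β.prod β) := by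
      simp only [rieszCoeff, real_inner_comm]
    rw [← h5]
    linarith
  have h3 := integral_mono_ae (integrable_const _) hint.integral_prod_right h2
  rw [integral_const, smul_eq_mul, ← Set.univ_prod_univ, measureReal_prod_prod] at h3
  linarith

end Lower

/-! ### Transfer of the lower bound to the extension integral -/

section Extension

variable {d : ℕ}

/-- Averaging over differences of two points of a ball of radius `R / 2` is controlled by
averaging over the ball of radius `R`. -/
lemma lintegral_prod_ball_sub_le (R : ℝ) {F : EuclideanSpace ℝ (Fin d) → ℝ≥0∞}
    (hF : Measurable F) :
    ∫⁻ p, F (p.1 - p.2) ∂((volume.restrict (Metric.ball (0 : EuclideanSpace ℝ (Fin d)) (R / 2))).prod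
      (volume.restrict (Metric.ball (0 : EuclideanSpace ℝ (Fin d)) (R / 2)))) ≤
    volume (Metric.ball (0 : EuclideanSpace ℝ (Fin d)) (R / 2)) *
      ∫⁻ x in Metric.ball (0 : EuclideanSpace ℝ (Fin d)) R, F x := by
  rw [lintegral_prod_symm _ (by fun_prop)]
  have h : ∀ y ∈ Metric.ball (0 : EuclideanSpace ℝ (Fin d)) (R / 2),
      ∫⁻ x in Metric.ball (0 : EuclideanSpace ℝ (Fin d)) (R / 2), F (x - y) ≤
      ∫⁻ x in Metric.ball (0 : EuclideanSpace ℝ (Fin d)) R, F x := fun y hy => by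
    rw [← lintegral_indicator Metric.isOpen_ball.measurableSet,
      ← lintegral_indicator Metric.isOpen_ball.measurableSet,
      ← lintegral_sub_right_eq_self
        ((Metric.ball (0 : EuclideanSpace ℝ (Fin d)) R).indicator fun x => F x) y]
    refine lintegral_mono fun x => ?_
    by_cases hx : x ∈ Metric.ball (0 : EuclideanSpace ℝ (Fin d)) (R / 2)
    · have : x - y ∈ Metric.ball (0 : EuclideanSpace ℝ (Fin d)) R := by
        rw [mem_ball_zero_iff] at *
        linarith [norm_sub_le x y]
      rw [Set.indicator_of_mem hx, Set.indicator_of_mem this]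
    · rw [Set.indicator_of_notMem hx]
      exact zero_le
  calc _ ≤ ∫⁻ _ in Metric.ball (0 : EuclideanSpace ℝ (Fin d)) (R / 2),
        ∫⁻ x in Metric.ball (0 : EuclideanSpace ℝ (Fin d)) R, F x :=
        setLIntegral_mono' Metric.isOpen_ball.measurableSet h
    _ = _ := by rw [lintegral_const, Measure.restrict_apply_univ, mul_comm]

lemma norm_sq_integral_exp (μ : Measure (EuclideanSpace ℝ (Fin d))) [IsFiniteMeasure μ]
    (x : EuclideanSpace ℝ (Fin d)) :
    ‖∫ ξ, Complex.exp (-2 * Real.pi * Complex.I * (inner ℝ x ξ : ℝ)) ∂μ‖ ^ 2 =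
      (∫ ξ, Real.cos (2 * Real.pi * inner ℝ x ξ) ∂μ) ^ 2 +
        (∫ ξ, Real.sin (2 * Real.pi * inner ℝ x ξ) ∂μ) ^ 2 := by
  have h1 : ∀ ξ, Complex.exp (-2 * Real.pi * Complex.I * (inner ℝ x ξ : ℝ)) =
      ((Real.cos (2 * Real.pi * inner ℝ x ξ) : ℝ) : ℂ) -
        ((Real.sin (2 * Real.pi * inner ℝ x ξ) : ℝ) : ℂ) * Complex.I := fun ξ => by
    have : -2 * (Real.pi : ℂ) * Complex.I * (inner ℝ x ξ : ℝ) =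
        ((-(2 * Real.pi * inner ℝ x ξ) : ℝ) : ℂ) * Complex.I := by push_cast; ring
    rw [this, Complex.exp_mul_I, ← Complex.ofReal_cos, ← Complex.ofReal_sin, Real.cos_neg,
      Real.sin_neg]
    push_cast; ring
  simp_rw [h1]
  rw [integral_sub (integrable_cos_inner μ x).ofReal ((integrable_sin_inner μ x).ofReal.mul_const _),
    integral_mul_const, integral_complex_ofReal, integral_complex_ofReal, Complex.sq_norm,
    Complex.normSq_apply]
  simp
  ring

/-- `riesz_lower_bound` is used with β uniform on the ball of radius R / 2. Differences of its
points lie in the ball of radius R with density at most the volume of the smaller ball, so one of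
the two volume factors cancels. -/
lemma lintegral_norm_sq_exp_mul_rieszProduct_ge {ι : Type*} (μ : Measure (EuclideanSpace ℝ (Fin d)))
    [IsFiniteMeasure μ] (η : ι → EuclideanSpace ℝ (Fin d)) (J : Finset ι)
    (q : EuclideanSpace ℝ (Fin d)) {ρ R : ℝ} (hR : 0 < R) (hρ : ρ * R ≤ 1 / 6)
    (hμ : ∀ᵐ ξ ∂μ, ∃ j ∈ J, ‖ξ - (q + η j)‖ ≤ ρ) :
    ENNReal.ofReal (1 / 16) * volume (Metric.ball (0 : EuclideanSpace ℝ (Fin d)) (R / 2)) *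
      μ Set.univ ^ 2 ≤
    ∫⁻ x in Metric.ball (0 : EuclideanSpace ℝ (Fin d)) R,
      ‖∫ ξ, Complex.exp (-2 * Real.pi * Complex.I * (inner ℝ x ξ : ℝ)) ∂μ‖ₑ ^ 2 *
        ENNReal.ofReal (rieszProduct η J x) := by
  set B := Metric.ball (0 : EuclideanSpace ℝ (Fin d)) (R / 2) with hB
  set β : Measure (EuclideanSpace ℝ (Fin d)) := volume.restrict B with hβ
  have hBtop : volume B ≠ ∞ := measure_ball_lt_top.ne
  have hBpos : volume B ≠ 0 := (Metric.measure_ball_pos _ _ (by linarith)).ne'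
  have : IsFiniteMeasure β := ⟨by simpa [hβ] using hBtop.lt_top⟩
  have hβμ : β Set.univ = volume B := by simp [hβ]
  have key := riesz_lower_bound β μ η J q (ρ := ρ) (M := R / 2) (by linarith)
    (by
      rw [hβ, ae_restrict_iff' Metric.isOpen_ball.measurableSet]
      exact ae_of_all _ fun y hy => (mem_ball_zero_iff.1 hy).le) hμ
  set F : EuclideanSpace ℝ (Fin d) → ℝ := fun x =>
    ((∫ ξ, Real.cos (2 * Real.pi * inner ℝ x ξ) ∂μ) ^ 2 +
        (∫ ξ, Real.sin (2 * Real.pi * inner ℝ x ξ) ∂μ) ^ 2) * rieszProduct η J x with hFdef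
  have hF0 : ∀ x, 0 ≤ F x := fun x => mul_nonneg (by positivity) (rieszProduct_nonneg _ _ _)
  have hFE : ∀ x, ENNReal.ofReal (F x) =
      ‖∫ ξ, Complex.exp (-2 * Real.pi * Complex.I * (inner ℝ x ξ : ℝ)) ∂μ‖ₑ ^ 2 *
        ENNReal.ofReal (rieszProduct η J x) := fun x => by
    simp only [hFdef]
    rw [← norm_sq_integral_exp, ENNReal.ofReal_mul (by positivity),
      ENNReal.ofReal_pow (norm_nonneg _), ofReal_norm]
  have hFm : Measurable F := by
    have hc : Continuous F := by
      have h1 : Continuous fun x : EuclideanSpace ℝ (Fin d) =>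
          ∫ ξ, Real.cos (2 * Real.pi * inner ℝ x ξ) ∂μ :=
        continuous_of_dominated (bound := fun _ => 1)
          (fun x => (integrable_cos_inner μ x).aestronglyMeasurable)
          (fun x => ae_of_all _ fun ξ => Real.abs_cos_le_one _) (integrable_const _)
          (ae_of_all _ fun ξ => by fun_prop)
      have h2 : Continuous fun x : EuclideanSpace ℝ (Fin d) =>
          ∫ ξ, Real.sin (2 * Real.pi * inner ℝ x ξ) ∂μ :=
        continuous_of_dominated (bound := fun _ => 1)
          (fun x => (integrable_sin_inner μ x).aestronglyMeasurable)
          (fun x => ae_of_all _ fun ξ => Real.abs_sin_le_one _) (integrable_const _)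
          (ae_of_all _ fun ξ => by fun_prop)
      exact ((h1.pow 2).add (h2.pow 2)).mul (continuous_rieszProduct η J)
    exact hc.measurable
  simp_rw [← hFE]
  replace key : 1 / 16 * β.real Set.univ ^ 2 * μ.real Set.univ ^ 2 ≤
    ∫ p : EuclideanSpace ℝ (Fin d) × EuclideanSpace ℝ (Fin d), F (p.1 - p.2) ∂(β.prod β) := key
  clear_value F
  have h0 := lintegral_prod_ball_sub_le R (F := fun x => ENNReal.ofReal (F x)) hFm.ennreal_ofReal
  have h1 : ENNReal.ofReal (1 / 16 * β.real Set.univ ^ 2 * μ.real Set.univ ^ 2) ≤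
      volume B * ∫⁻ x in Metric.ball (0 : EuclideanSpace ℝ (Fin d)) R, ENNReal.ofReal (F x) := by
    refine (ENNReal.ofReal_le_ofReal key).trans ?_
    rw [integral_eq_lintegral_of_nonneg_ae (ae_of_all _ fun p : EuclideanSpace ℝ (Fin d) × EuclideanSpace ℝ (Fin d) => hF0 (p.1 - p.2))
      (hFm.comp (measurable_fst.sub measurable_snd)).aestronglyMeasurable]
    exact ENNReal.ofReal_toReal_le.trans h0
  rw [ENNReal.ofReal_mul (by positivity), ENNReal.ofReal_mul (by positivity),
    ENNReal.ofReal_pow measureReal_nonneg, ENNReal.ofReal_pow measureReal_nonneg,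
    ofReal_measureReal, ofReal_measureReal, hβμ] at h1
  refine (ENNReal.mul_le_mul_iff_right hBpos hBtop).1 (le_trans (le_of_eq ?_) h1)
  ring

end Extension


/-! ### Riesz products on a line -/

section Gaussian

/-- The Fourier coefficient with frequency `θ` and phase `a` of the one-dimensional Riesz product
with frequencies `b` and phases `p`, with respect to a Gaussian of width `R`. -/
noncomputable def gaussianRieszCoeff (R : ℝ) (p b : ℕ → ℝ) (a θ : ℝ) (J : Finset ℕ) : ℝ :=
  ∫ t : ℝ, Real.exp (-(Real.pi / R ^ 2) * t ^ 2) * (Real.cos (2 * Real.pi * (a + t * θ)) *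
    ∏ j ∈ J, (1 + Real.cos (2 * Real.pi * (p j + t * b j))))

variable {R : ℝ} (p b : ℕ → ℝ)

lemma integrable_gaussianRieszCoeff (hR : 0 < R) (a θ : ℝ) (J : Finset ℕ) :
    Integrable fun t : ℝ => Real.exp (-(Real.pi / R ^ 2) * t ^ 2) *
      (Real.cos (2 * Real.pi * (a + t * θ)) *
        ∏ j ∈ J, (1 + Real.cos (2 * Real.pi * (p j + t * b j)))) := by
  refine (integrable_exp_neg_mul_sq (b := Real.pi / R ^ 2) (by positivity)).mul_bdd
    (c := 2 ^ J.card) (by fun_prop) (ae_of_all _ fun t => ?_)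
  rw [norm_mul, Real.norm_eq_abs, ← one_mul ((2 : ℝ) ^ _), norm_prod, ← Finset.prod_const]
  refine mul_le_mul (Real.abs_cos_le_one _) (Finset.prod_le_prod (fun _ _ => norm_nonneg _)
    fun j _ => ?_) (Finset.prod_nonneg fun _ _ => norm_nonneg _) zero_le_one
  rw [Real.norm_eq_abs, abs_le]
  constructor <;> linarith [Real.cos_le_one (2 * Real.pi * (p j + t * b j)),
    Real.neg_one_le_cos (2 * Real.pi * (p j + t * b j))]

lemma gaussianRieszCoeff_insert (hR : 0 < R) (a θ : ℝ) {J : Finset ℕ} {i : ℕ} (hi : i ∉ J) :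
    gaussianRieszCoeff R p b a θ (insert i J) = gaussianRieszCoeff R p b a θ J +
      (1 / 2) * gaussianRieszCoeff R p b (a + p i) (θ + b i) J +
      (1 / 2) * gaussianRieszCoeff R p b (a - p i) (θ - b i) J := by
  have hI := integrable_gaussianRieszCoeff p b hR
  unfold gaussianRieszCoeff
  rw [← integral_const_mul, ← integral_const_mul, ← integral_add (hI _ _ _) ((hI _ _ _).const_mul _),
    ← integral_add]
  congr 1
  ext t
  have h1 : 2 * Real.pi * (a + p i + t * (θ + b i)) =
    2 * Real.pi * (a + t * θ) + 2 * Real.pi * (p i + t * b i) := by ring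
  have h2 : 2 * Real.pi * (a - p i + t * (θ - b i)) =
    2 * Real.pi * (a + t * θ) - 2 * Real.pi * (p i + t * b i) := by ring
  rw [Finset.prod_insert hi, h1, h2, Real.cos_add, Real.cos_sub]
  ring
  exacts [(hI _ _ _).add ((hI _ _ _).const_mul _), (hI _ _ _).const_mul _]

lemma abs_gaussianRieszCoeff_empty_le (hR : 0 < R) (a θ : ℝ) :
    |gaussianRieszCoeff R p b a θ ∅| ≤ R * Real.exp (-(Real.pi * R ^ 2 * θ ^ 2)) := by
  have hb : (0 : ℝ) < (((Real.pi / R ^ 2 : ℝ)) : ℂ).re := by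
    rw [Complex.ofReal_re]; positivity
  have hF := fourierIntegral_gaussian hb ((2 * Real.pi * θ : ℝ) : ℂ)
  have h1 : ((gaussianRieszCoeff R p b a θ ∅ : ℝ)) =
      (Complex.exp ((2 * Real.pi * a : ℝ) * Complex.I) *
        ∫ x : ℝ, Complex.exp (Complex.I * (2 * Real.pi * θ : ℝ) * x) *
          Complex.exp (-((Real.pi / R ^ 2 : ℝ)) * x ^ 2)).re := by
    rw [← integral_const_mul]
    have hint : Integrable fun x : ℝ => Complex.exp ((2 * Real.pi * a : ℝ) * Complex.I) *
        (Complex.exp (Complex.I * (2 * Real.pi * θ : ℝ) * x) *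
          Complex.exp (-((Real.pi / R ^ 2 : ℝ)) * x ^ 2)) := by
      refine Integrable.const_mul ?_ _
      refine (integrable_cexp_neg_mul_sq hb).bdd_mul (c := 1) (by fun_prop)
        (ae_of_all _ fun t => ?_)
      rw [show Complex.I * (2 * Real.pi * θ : ℝ) * t = ((2 * Real.pi * θ * t : ℝ) : ℂ) * Complex.I by
        push_cast; ring, Complex.norm_exp_ofReal_mul_I]
    refine Eq.trans ?_ (integral_re hint)
    unfold gaussianRieszCoeff
    congr 1
    ext t
    have : Complex.exp ((2 * Real.pi * a : ℝ) * Complex.I) *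
        (Complex.exp (Complex.I * (2 * Real.pi * θ : ℝ) * t) *
          Complex.exp (-((Real.pi / R ^ 2 : ℝ)) * t ^ 2)) =
        Complex.exp ((2 * Real.pi * (a + t * θ) : ℝ) * Complex.I) *
          ((Real.exp (-(Real.pi / R ^ 2) * t ^ 2) : ℝ) : ℂ) := by
      rw [Complex.ofReal_exp, ← Complex.exp_add, ← Complex.exp_add, ← Complex.exp_add]
      congr 1
      push_cast
      ring
    rw [this]
    simp only [RCLike.re_eq_complex_re, Complex.re_mul_ofReal, Complex.exp_ofReal_mul_I_re,
      Finset.prod_empty, mul_one]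
    ring
  rw [h1, hF]
  refine (Complex.abs_re_le_norm _).trans ?_
  rw [norm_mul, Complex.norm_exp_ofReal_mul_I, one_mul, norm_mul]
  have h2 : ((Real.pi : ℂ) / ((Real.pi / R ^ 2 : ℝ) : ℂ)) ^ (1 / 2 : ℂ) = ((R : ℝ) : ℂ) := by
    have : ((Real.pi : ℂ) / ((Real.pi / R ^ 2 : ℝ) : ℂ)) = ((R ^ 2 : ℝ) : ℂ) := by
      rw [← Complex.ofReal_div]
      congr 1
      field_simp
    rw [this, show (1 / 2 : ℂ) = ((1 / 2 : ℝ) : ℂ) by push_cast; ring,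
      ← Complex.ofReal_cpow (by positivity), ← Real.sqrt_eq_rpow, Real.sqrt_sq hR.le]
  have h3 : (-((2 * Real.pi * θ : ℝ) : ℂ) ^ 2 / (4 * ((Real.pi / R ^ 2 : ℝ) : ℂ))) =
      ((-(Real.pi * R ^ 2 * θ ^ 2) : ℝ) : ℂ) := by
    push_cast
    have := Real.pi_ne_zero
    have h' : (Real.pi : ℂ) ≠ 0 := by exact_mod_cast this
    have h'' : (R : ℂ) ≠ 0 := by exact_mod_cast hR.ne'
    field_simp
    ring
  rw [h2, h3, ← Complex.ofReal_exp, Complex.norm_real, Complex.norm_real, Real.norm_eq_abs,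
    Real.norm_eq_abs, abs_of_pos hR, abs_of_pos (Real.exp_pos _)]

/-- The spectrum of the product lies in [−∑|b j|, ∑|b j|], so after modulation by θ all frequencies
have modulus at least δ, where the Gaussian transform is tiny. Each factor multiplies the error by 1
+ 1/2 + 1/2 = 2. Arbitrary phases rule out positivity, hence the absolute values. -/
lemma abs_gaussianRieszCoeff_le_of_le (hR : 0 < R) {δ : ℝ} (hδ : 0 ≤ δ) (J : Finset ℕ) :
    ∀ a θ : ℝ, ∑ j ∈ J, |b j| + δ ≤ |θ| →
      |gaussianRieszCoeff R p b a θ J| ≤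
        2 ^ J.card * (R * Real.exp (-(Real.pi * R ^ 2 * δ ^ 2))) := by
  induction J using Finset.induction_on with
  | empty =>
    intro a θ h
    refine (abs_gaussianRieszCoeff_empty_le p b hR a θ).trans ?_
    rw [Finset.sum_empty, zero_add] at h
    have : δ ^ 2 ≤ θ ^ 2 := by rw [← sq_abs θ]; gcongr
    rw [Finset.card_empty, pow_zero, one_mul]
    gcongr
  | insert i J hi ih =>
    intro a θ h
    rw [Finset.sum_insert hi] at h
    rw [gaussianRieszCoeff_insert p b hR a θ hi, Finset.card_insert_of_notMem hi, pow_succ]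
    have h0 := ih a θ (by linarith [abs_nonneg (b i)])
    have h1 := ih (a + p i) (θ + b i) (by
      have := abs_sub_abs_le_abs_sub θ (-b i)
      rw [abs_neg, sub_neg_eq_add] at this
      linarith)
    have h2 := ih (a - p i) (θ - b i) (by linarith [abs_sub_abs_le_abs_sub θ (b i)])
    rw [abs_le] at *
    constructor <;> linarith [h0.1, h0.2, h1.1, h1.2, h2.1, h2.2]

/-- The Gaussian average of a Riesz product with lacunary frequencies is bounded. -/
lemma gaussianRieszCoeff_zero_le (hR : 0 < R) {δ : ℝ} (hδ : 0 ≤ δ) (J : Finset ℕ)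
    (h : ∀ a ∈ J, ∑ j ∈ J with a < j, |b j| + δ ≤ |b a|) :
    gaussianRieszCoeff R p b 0 0 J ≤
      R + 2 ^ J.card * (R * Real.exp (-(Real.pi * R ^ 2 * δ ^ 2))) := by
  -- Smaller indices carry larger frequencies. The index added is the smallest, so its frequency
  -- dominates all those already present and both of its translates are error terms.
  induction J using Finset.induction_on_min with
  | empty =>
    have := (abs_le.1 (abs_gaussianRieszCoeff_empty_le p b hR 0 0)).2
    have h' : 0 < R * Real.exp (-(Real.pi * R ^ 2 * δ ^ 2)) := by positivity
    rw [Finset.card_empty, pow_zero, one_mul]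
    simp only [ne_eq, OfNat.ofNat_ne_zero, not_false_eq_true, zero_pow, mul_zero, neg_zero,
      Real.exp_zero, mul_one] at this
    linarith
  | insert i J hi ih =>
    have hi' : i ∉ J := fun hm => lt_irrefl _ (hi i hm)
    have h0 := ih fun a ha => by
      have := h a (Finset.mem_insert_of_mem ha)
      rwa [Finset.filter_insert, if_neg (hi a ha).not_gt] at this
    have h1 := h i (Finset.mem_insert_self i J)
    rw [Finset.filter_insert, if_neg (lt_irrefl i), Finset.filter_true_of_mem hi] at h1
    have h2 := abs_gaussianRieszCoeff_le_of_le p b hR hδ J (0 + p i) (0 + b i) (by rwa [zero_add])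
    have h3 := abs_gaussianRieszCoeff_le_of_le p b hR hδ J (0 - p i) (0 - b i)
      (by rwa [zero_sub, abs_neg])
    rw [gaussianRieszCoeff_insert p b hR 0 0 hi', Finset.card_insert_of_notMem hi', pow_succ]
    linarith [(abs_le.1 h2).2, (abs_le.1 h3).2]

end Gaussian

section Line

variable {E : Type*} [NormedAddCommGroup E] [InnerProductSpace ℝ E]

/-- The integral of a Riesz product over a segment of length `4 R`, if up to few exceptions the
frequencies are lacunary in the direction of the segment. -/
lemma lintegral_rieszProduct_le (η : ℕ → E) {J G : Finset ℕ} (hG : G ⊆ J) {R δ : ℝ} (hR : 0 < R)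
    (hδ : 0 ≤ δ) {m : ℕ} (hm : (J \ G).card ≤ m) (v : E)
    (h : ∀ a ∈ G, ∑ j ∈ G with a < j, |inner ℝ (η j) v| + δ ≤ |inner ℝ (η a) v|)
    (hδR : 2 ^ J.card * Real.exp (-(Real.pi * R ^ 2 * δ ^ 2)) ≤ 1) (x : E) :
    ∫⁻ t in Set.Icc (-(2 * R)) (2 * R), ENNReal.ofReal (rieszProduct η J (x + t • v)) ≤
      ENNReal.ofReal (2 ^ (m + 1) * Real.exp (4 * Real.pi) * R) := by
  set p : ℕ → ℝ := fun j => inner ℝ (η j) x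
  set b : ℕ → ℝ := fun j => inner ℝ (η j) v
  have hr : ∀ K : Finset ℕ, ∀ t : ℝ, rieszProduct η K (x + t • v) =
      ∏ j ∈ K, (1 + Real.cos (2 * Real.pi * (p j + t * b j))) := fun K t => by
    simp only [rieszProduct, inner_add_right, inner_smul_right, p, b]
  have h1 := integrable_gaussianRieszCoeff p b hR 0 0 G
  have h2 := gaussianRieszCoeff_zero_le p b hR hδ G h
  have h3 : (2 : ℝ) ^ G.card * (R * Real.exp (-(Real.pi * R ^ 2 * δ ^ 2))) ≤ R := by
    calc (2 : ℝ) ^ G.card * (R * Real.exp (-(Real.pi * R ^ 2 * δ ^ 2)))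
        ≤ 2 ^ J.card * (R * Real.exp (-(Real.pi * R ^ 2 * δ ^ 2))) := by
          gcongr
          · norm_num
      _ = R * (2 ^ J.card * Real.exp (-(Real.pi * R ^ 2 * δ ^ 2))) := by ring
      _ ≤ R * 1 := by gcongr
      _ = R := mul_one R
  simp only [gaussianRieszCoeff, mul_zero, add_zero, Real.cos_zero, one_mul] at h1 h2
  have h4 : ∀ t ∈ Set.Icc (-(2 * R)) (2 * R), ENNReal.ofReal (rieszProduct η J (x + t • v)) ≤
      ENNReal.ofReal (2 ^ m * Real.exp (4 * Real.pi) * (Real.exp (-(Real.pi / R ^ 2) * t ^ 2) *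
        ∏ j ∈ G, (1 + Real.cos (2 * Real.pi * (p j + t * b j))))) := fun t ht => by
    refine ENNReal.ofReal_le_ofReal ?_
    have h5 : rieszProduct η J (x + t • v) =
        rieszProduct η (J \ G) (x + t • v) * rieszProduct η G (x + t • v) :=
      (Finset.prod_sdiff hG).symm
    have h6 : rieszProduct η (J \ G) (x + t • v) ≤ 2 ^ m :=
      (rieszProduct_le _ _ _).trans (pow_le_pow_right₀ (by norm_num) hm)
    -- On |t| ≤ 2R the Gaussian is at least e^{-4π}, so it may replace the sharp cutoff.
    have h7 : 1 ≤ Real.exp (4 * Real.pi) * Real.exp (-(Real.pi / R ^ 2) * t ^ 2) := by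
      rw [← Real.exp_add]
      apply Real.one_le_exp
      have h8 : t ^ 2 ≤ (2 * R) ^ 2 := sq_le_sq' ht.1 ht.2
      have h9 : Real.pi / R ^ 2 * t ^ 2 ≤ Real.pi / R ^ 2 * (2 * R) ^ 2 := by gcongr
      have h10 : Real.pi / R ^ 2 * (2 * R) ^ 2 = 4 * Real.pi := by field_simp; ring
      linarith
    rw [h5, ← hr]
    calc rieszProduct η (J \ G) (x + t • v) * rieszProduct η G (x + t • v)
        ≤ 2 ^ m * rieszProduct η G (x + t • v) :=
          mul_le_mul_of_nonneg_right h6 (rieszProduct_nonneg _ _ _)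
      _ = 2 ^ m * rieszProduct η G (x + t • v) * 1 := by ring
      _ ≤ 2 ^ m * rieszProduct η G (x + t • v) *
          (Real.exp (4 * Real.pi) * Real.exp (-(Real.pi / R ^ 2) * t ^ 2)) :=
          mul_le_mul_of_nonneg_left h7 (mul_nonneg (by positivity) (rieszProduct_nonneg _ _ _))
      _ = _ := by ring
  have hnn : ∀ t : ℝ, 0 ≤ 2 ^ m * Real.exp (4 * Real.pi) * (Real.exp (-(Real.pi / R ^ 2) * t ^ 2) *
        ∏ j ∈ G, (1 + Real.cos (2 * Real.pi * (p j + t * b j)))) := fun t => by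
    rw [← hr]
    exact mul_nonneg (by positivity) (mul_nonneg (by positivity) (rieszProduct_nonneg _ _ _))
  refine (setLIntegral_mono' measurableSet_Icc h4).trans ((setLIntegral_le_lintegral _ _).trans ?_)
  rw [← ofReal_integral_eq_lintegral_ofReal (h1.const_mul _) (ae_of_all _ hnn), integral_const_mul]
  refine ENNReal.ofReal_le_ofReal ?_
  calc _ ≤ 2 ^ m * Real.exp (4 * Real.pi) * (R + R) := by
        refine mul_le_mul_of_nonneg_left ?_ (by positivity)
        linarith
    _ = _ := by ring

end Line


/-! ### Lacunarity of combinations of geometric sequences -/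

section Lacunary

variable {d : ℕ} {L r : ℝ} {s : Fin d → ℕ → ℝ} {A : Fin d → ℝ}

lemma geom_pow_le (hL : 1 ≤ L) {j k : ℕ} (hjk : j ≤ k) (n : ℕ) (hr : 0 < r) :
    (r * (L⁻¹) ^ k) ^ (n + 1) ≤ (L⁻¹) ^ (k - j) * (r * (L⁻¹) ^ j) ^ (n + 1) := by
  obtain ⟨e, rfl⟩ := Nat.exists_eq_add_of_le hjk
  have hL0 : 0 < L⁻¹ := by positivity
  have hL1 : L⁻¹ ^ e ≤ 1 := pow_le_one₀ hL0.le (inv_le_one_of_one_le₀ hL)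
  have : (L⁻¹ ^ e) ^ (n + 1) ≤ L⁻¹ ^ e := by
    rw [pow_succ]
    exact mul_le_of_le_one_left (by positivity) (pow_le_one₀ (by positivity) hL1)
  rw [Nat.add_sub_cancel_left, pow_add L⁻¹, ← mul_assoc, mul_pow _ (L⁻¹ ^ e), mul_comm]
  gcongr

lemma abs_le_of_geom (hL : 1 ≤ L) (hr : 0 < r) (hA : ∀ i, 0 < A i)
    (hlow : ∀ i j, A i * (r * (L⁻¹) ^ j) ^ ((i : ℕ) + 1) ≤ |s i j|)
    (hup : ∀ i j, |s i j| ≤ 3 * A i * (r * (L⁻¹) ^ j) ^ ((i : ℕ) + 1)) (i : Fin d) {j k : ℕ}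
    (hjk : j ≤ k) : |s i k| ≤ 3 * (L⁻¹) ^ (k - j) * |s i j| := by
  have hL0 : 0 < L⁻¹ := by positivity
  have hA' := hA i
  calc |s i k| ≤ 3 * A i * (r * (L⁻¹) ^ k) ^ ((i : ℕ) + 1) := hup i k
    _ ≤ 3 * A i * ((L⁻¹) ^ (k - j) * (r * (L⁻¹) ^ j) ^ ((i : ℕ) + 1)) := by
      gcongr
      exact geom_pow_le hL hjk i hr
    _ = 3 * (L⁻¹) ^ (k - j) * (A i * (r * (L⁻¹) ^ j) ^ ((i : ℕ) + 1)) := by ring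
    _ ≤ _ := by gcongr; exact hlow i j

/-- The ratio |s i'| / |s i| behaves like a positive power of r L^{-j}, so it drops by a factor L or
more from j to k. The 9 is the loss from two uses of the two-sided bounds. -/
lemma mul_abs_mul_abs_le_of_geom (hL : 1 ≤ L) (hr : 0 < r) (hA : ∀ i, 0 < A i)
    (hlow : ∀ i j, A i * (r * (L⁻¹) ^ j) ^ ((i : ℕ) + 1) ≤ |s i j|)
    (hup : ∀ i j, |s i j| ≤ 3 * A i * (r * (L⁻¹) ^ j) ^ ((i : ℕ) + 1)) {i i' : Fin d} (hi : i < i')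
    {j k : ℕ} (hjk : j < k) : L * (|s i' k| * |s i j|) ≤ 9 * (|s i' j| * |s i k|) := by
  have hL0 : 0 < L⁻¹ := by positivity
  have h1 := hA i
  have h2 := hA i'
  obtain ⟨e, he⟩ := Nat.exists_eq_add_of_lt (Fin.lt_def.1 hi)
  have hx : 0 < r * L⁻¹ ^ j := by positivity
  have hy : 0 < r * L⁻¹ ^ k := by positivity
  have h3 : L * (r * L⁻¹ ^ k) ^ (e + 1) ≤ (r * L⁻¹ ^ j) ^ (e + 1) := by
    have h4 := geom_pow_le hL hjk.le e hr
    have h5 : L⁻¹ ^ (k - j) ≤ L⁻¹ ^ 1 :=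
      pow_le_pow_of_le_one hL0.le (inv_le_one_of_one_le₀ hL) (by omega)
    calc L * (r * L⁻¹ ^ k) ^ (e + 1) ≤ L * (L⁻¹ ^ (k - j) * (r * L⁻¹ ^ j) ^ (e + 1)) := by gcongr
      _ ≤ L * (L⁻¹ ^ 1 * (r * L⁻¹ ^ j) ^ (e + 1)) := by gcongr
      _ = _ := by field_simp
  calc L * (|s i' k| * |s i j|)
      ≤ L * ((3 * A i' * (r * L⁻¹ ^ k) ^ ((i' : ℕ) + 1)) *
          (3 * A i * (r * L⁻¹ ^ j) ^ ((i : ℕ) + 1))) := by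
        gcongr
        · exact hup i' k
        · exact hup i j
    _ = 9 * (A i * A i' * (r * L⁻¹ ^ k) ^ ((i : ℕ) + 1) * (r * L⁻¹ ^ j) ^ ((i : ℕ) + 1)) *
        (L * (r * L⁻¹ ^ k) ^ (e + 1)) := by rw [he]; ring
    _ ≤ 9 * (A i * A i' * (r * L⁻¹ ^ k) ^ ((i : ℕ) + 1) * (r * L⁻¹ ^ j) ^ ((i : ℕ) + 1)) *
        (r * L⁻¹ ^ j) ^ (e + 1) := by gcongr
    _ = 9 * ((A i' * (r * L⁻¹ ^ j) ^ ((i' : ℕ) + 1)) * (A i * (r * L⁻¹ ^ k) ^ ((i : ℕ) + 1))) := by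
        rw [he]; ring
    _ ≤ _ := by
        gcongr
        · exact hlow i' j
        · exact hlow i k

/-- A linear combination of `d` geometric-like sequences of different rates is lacunary, up to at
most `d ^ 2` exceptional terms. -/
lemma exists_lacunary_subset (hr : 0 < r) (hL : L = 9 * (2 * d + 1) ^ 2) (hA : ∀ i, 0 < A i)
    (hlow : ∀ i j, A i * (r * (L⁻¹) ^ j) ^ ((i : ℕ) + 1) ≤ |s i j|)
    (hup : ∀ i j, |s i j| ≤ 3 * A i * (r * (L⁻¹) ^ j) ^ ((i : ℕ) + 1))
    (α : Fin d → ℝ) (N : ℕ) {δ : ℝ} (hδ : 0 < δ) (i₀ : Fin d)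
    (hα : ∀ k < N, 4 * δ ≤ |α i₀ * s i₀ k|) :
    ∃ G ⊆ Finset.range N, (Finset.range N \ G).card ≤ d ^ 2 ∧
      ∀ a ∈ G, ∑ j ∈ G with a < j, |∑ i, α i * s i j| + δ ≤ |∑ i, α i * s i a| := by
  classical
  have hd : 0 < d := i₀.pos
  have hd' : (1 : ℝ) ≤ d := by exact_mod_cast hd
  have hL1 : 1 ≤ L := by rw [hL]; nlinarith
  have hL0 : 0 < L⁻¹ := by positivity
  set u : Fin d → ℕ → ℝ := fun i j => |α i * s i j| with hu
  have hu0 : ∀ i j, 0 ≤ u i j := fun i j => abs_nonneg _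
  -- At a bad index two different coordinates contribute comparably, within a factor 2d. If a pair
  -- were bad at j < k, the ratio estimate would give L ≤ 9(2d)², contrary to the choice of L. So
  -- each of the d² pairs has at most one bad index.
  let bad : Fin d × Fin d → ℕ → Prop := fun q j =>
    q.1 < q.2 ∧ 0 < u q.1 j ∧ 0 < u q.2 j ∧ u q.1 j ≤ 2 * d * u q.2 j ∧ u q.2 j ≤ 2 * d * u q.1 j
  have hbad : ∀ q j k, bad q j → bad q k → ¬ j < k := by
    rintro ⟨i, i'⟩ j k ⟨h1, h2, h3, h4, h5⟩ ⟨-, h6, h7, h8, h9⟩ hjk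
    simp only at *
    have h10 := mul_abs_mul_abs_le_of_geom hL1 hr hA hlow hup h1 hjk
    have h11 : L * (u i' k * u i j) ≤ 9 * (u i' j * u i k) := by
      have := mul_le_mul_of_nonneg_left h10 (show 0 ≤ |α i'| * |α i| by positivity)
      simp only [hu, abs_mul]
      linarith
    have h12 : u i' j * u i k ≤ (2 * d * u i j) * (2 * d * u i' k) :=
      mul_le_mul h5 h8 h6.le (by positivity)
    have h13 : 0 < u i' k * u i j := by positivity
    rw [hL] at h11
    nlinarith
  refine ⟨(Finset.range N).filter fun j => ∀ q, ¬ bad q j, Finset.filter_subset _ _, ?_, ?_⟩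
  · have h1 : Finset.range N \ ((Finset.range N).filter fun j => ∀ q, ¬ bad q j) ⊆
        Finset.univ.biUnion fun q => (Finset.range N).filter (bad q) := by
      intro j hj
      simp only [Finset.mem_sdiff, Finset.mem_filter, not_and, not_forall, not_not] at hj
      obtain ⟨q, hq⟩ := hj.2 hj.1
      exact Finset.mem_biUnion.2 ⟨q, Finset.mem_univ _, Finset.mem_filter.2 ⟨hj.1, hq⟩⟩
    refine (Finset.card_le_card h1).trans (Finset.card_biUnion_le.trans ?_)
    calc ∑ q : Fin d × Fin d, ((Finset.range N).filter (bad q)).card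
        ≤ ∑ _q : Fin d × Fin d, 1 := by
          refine Finset.sum_le_sum fun q _ => Finset.card_le_one.2 fun j hj k hk => ?_
          have hj' := (Finset.mem_filter.1 hj).2
          have hk' := (Finset.mem_filter.1 hk).2
          exact le_antisymm (not_lt.1 (hbad q k j hk' hj')) (not_lt.1 (hbad q j k hj' hk'))
      _ = d ^ 2 := by simp [sq]
  · intro a ha
    obtain ⟨haN, ha⟩ := Finset.mem_filter.1 ha
    -- At a good index the largest term exceeds 2d times every other, so the combination is at least
    -- half of it. The later terms sum to at most a quarter and δ is at most a quarter.
    obtain ⟨i₁, -, hi₁⟩ := Finset.exists_max_image Finset.univ (fun i => u i a) ⟨i₀, Finset.mem_univ _⟩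
    have hm : 4 * δ ≤ u i₁ a :=
      (hα a (Finset.mem_range.1 haN)).trans (hi₁ i₀ (Finset.mem_univ _))
    have hsmall : ∀ i ≠ i₁, 2 * d * u i a ≤ u i₁ a := by
      intro i hi
      by_contra! hc
      have hpos : 0 < u i a := by
        by_contra! h0
        have : 2 * d * u i a ≤ 0 := mul_nonpos_of_nonneg_of_nonpos (by positivity) h0
        linarith
      have h1 := hi₁ i (Finset.mem_univ _)
      have h2 : u i a ≤ 2 * d * u i₁ a := by nlinarith [hu0 i₁ a]
      rcases lt_or_gt_of_ne hi with h | h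
      · exact ha (i, i₁) ⟨h, hpos, by linarith, h2, hc.le⟩
      · exact ha (i₁, i) ⟨h, by linarith, hpos, hc.le, h2⟩
    have hlower : u i₁ a / 2 ≤ |∑ i, α i * s i a| := by
      rw [← Finset.add_sum_erase _ _ (Finset.mem_univ i₁)]
      have h1 : |∑ i ∈ Finset.univ.erase i₁, α i * s i a| ≤ u i₁ a / 2 := by
        refine (Finset.abs_sum_le_sum_abs _ _).trans ?_
        calc ∑ i ∈ Finset.univ.erase i₁, |α i * s i a|
            ≤ ∑ _i ∈ Finset.univ.erase i₁, u i₁ a / (2 * d) := by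
              refine Finset.sum_le_sum fun i hi => ?_
              rw [le_div_iff₀ (by positivity)]
              have := hsmall i (Finset.ne_of_mem_erase hi)
              simp only [hu] at *
              linarith
          _ ≤ ∑ _i : Fin d, u i₁ a / (2 * d) := by
              refine Finset.sum_le_sum_of_subset_of_nonneg (Finset.erase_subset _ _) fun _ _ _ => ?_
              have := hu0 i₁ a
              positivity
          _ = u i₁ a / 2 := by
              rw [Finset.sum_const, Finset.card_univ, Fintype.card_fin, nsmul_eq_mul]
              field_simp
      have h2 := abs_sub_abs_le_abs_sub (α i₁ * s i₁ a) (-∑ i ∈ Finset.univ.erase i₁, α i * s i a)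
      rw [abs_neg, sub_neg_eq_add] at h2
      simp only [hu] at *
      linarith
    have hupper : ∀ k, a ≤ k → |∑ i, α i * s i k| ≤ 3 * d * u i₁ a * L⁻¹ ^ (k - a) := by
      intro k hk
      refine (Finset.abs_sum_le_sum_abs _ _).trans ?_
      calc ∑ i, |α i * s i k| ≤ ∑ _i : Fin d, 3 * L⁻¹ ^ (k - a) * u i₁ a := by
            refine Finset.sum_le_sum fun i _ => ?_
            have h1 := abs_le_of_geom hL1 hr hA hlow hup i hk
            calc |α i * s i k| = |α i| * |s i k| := abs_mul _ _
              _ ≤ |α i| * (3 * L⁻¹ ^ (k - a) * |s i a|) := by gcongr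
              _ = 3 * L⁻¹ ^ (k - a) * u i a := by simp only [hu, abs_mul]; ring
              _ ≤ _ := by
                gcongr
                exact hi₁ i (Finset.mem_univ _)
        _ = _ := by
            rw [Finset.sum_const, Finset.card_univ, Fintype.card_fin, nsmul_eq_mul]
            ring
    have hsum : ∑ j ∈ ((Finset.range N).filter fun j => ∀ q, ¬ bad q j) with a < j,
        |∑ i, α i * s i j| ≤ u i₁ a / 4 := by
      have hL81 : 81 ≤ L := by rw [hL]; nlinarith
      have hLd : 24 * d ≤ L := by rw [hL]; nlinarith
      calc _ ≤ ∑ j ∈ Finset.Ico (a + 1) N, 3 * d * u i₁ a * L⁻¹ ^ (j - a) := by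
            refine (Finset.sum_le_sum fun j hj => hupper j (Finset.mem_filter.1 hj).2.le).trans ?_
            refine Finset.sum_le_sum_of_subset_of_nonneg (fun j hj => ?_) fun _ _ _ => ?_
            · simp only [Finset.mem_filter, Finset.mem_range, Finset.mem_Ico] at *
              omega
            · have := hu0 i₁ a
              positivity
        _ = 3 * d * u i₁ a * ∑ e ∈ Finset.range (N - (a + 1)), L⁻¹ ^ (e + 1) := by
            rw [← Finset.mul_sum, Finset.sum_Ico_eq_sum_range]
            congr 1
            refine Finset.sum_congr rfl fun e _ => ?_
            congr 1
            omega
        _ ≤ 3 * d * u i₁ a * (2 * L⁻¹) := by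
            have := hu0 i₁ a
            gcongr
            have hx : L⁻¹ ≤ 1 / 2 := by
              rw [inv_le_comm₀ (by linarith) (by norm_num)]; linarith
            simp_rw [pow_succ]
            rw [← Finset.sum_mul]
            gcongr
            exact (Finset.sum_le_sum fun e _ => pow_le_pow_left₀ hL0.le hx e).trans
              (sum_geometric_two_le _)
        _ = 6 * d * L⁻¹ * u i₁ a := by ring
        _ ≤ 1 / 4 * u i₁ a := by
            have := hu0 i₁ a
            gcongr
            rw [← div_eq_mul_inv, div_le_iff₀ (by linarith)]
            linarith
        _ = _ := by ring
    linarith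

end Lacunary


/-! ### Flat graphs and the existence of a curved point -/

section Flat

lemma eq_add_of_hasDerivAt_of_hasDerivAt_zero {h h' : ℝ → ℝ} (h1 : ∀ t, HasDerivAt h (h' t) t)
    (h2 : ∀ t ∈ Set.Icc (0 : ℝ) 1, HasDerivAt h' 0 t) : h 1 = h 0 + h' 0 := by
  obtain ⟨c, hc, hc'⟩ := exists_hasDerivAt_eq_slope h h' zero_lt_one
    (fun t _ => (h1 t).continuousAt.continuousWithinAt) fun t _ => h1 t
  obtain ⟨e, he, he'⟩ := exists_hasDerivAt_eq_slope h' (fun _ => 0) hc.1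
    (fun t ht => (h2 t ⟨ht.1, ht.2.trans hc.2.le⟩).continuousAt.continuousWithinAt)
    fun t ht => h2 t ⟨ht.1.le, ht.2.le.trans hc.2.le⟩
  have := hc.1.ne'
  rw [eq_div_iff (by simpa using this), zero_mul] at he'
  rw [sub_zero, div_one] at hc'
  linarith

variable {F : Type*} [NormedAddCommGroup F] [NormedSpace ℝ F]

lemma ContDiff.hasDerivAt_fderiv_line {φ : F → ℝ} (hφ : ContDiff ℝ 2 φ) {z : ℝ → F} {z' : F}
    {t : ℝ} (hz : HasDerivAt z z' t) :
    HasDerivAt (fun t => fderiv ℝ φ (z t)) (fderiv ℝ (fderiv ℝ φ) (z t) z') t := by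
  have h : Differentiable ℝ (fderiv ℝ φ) :=
    (hφ.fderiv_right (m := 1) (by norm_num)).differentiable (by norm_num)
  exact (h (z t)).hasFDerivAt.comp_hasDerivAt t hz

lemma eq_add_fderiv_of_convex {φ : F → ℝ} (hφ : ContDiff ℝ 2 φ) {B : Set F} (hB : Convex ℝ B)
    (h : ∀ z ∈ B, ∀ e, fderiv ℝ (fderiv ℝ φ) z e e = 0) {z z' : F} (hz : z ∈ B) (hz' : z' ∈ B) :
    φ z' = φ z + fderiv ℝ φ z (z' - z) := by
  have hline : ∀ t : ℝ, HasDerivAt (fun t : ℝ => z + t • (z' - z)) (z' - z) t := fun t => by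
    simpa using ((hasDerivAt_id t).smul_const (z' - z)).const_add z
  have h1 : ∀ t : ℝ, HasDerivAt (fun t : ℝ => φ (z + t • (z' - z)))
      (fderiv ℝ φ (z + t • (z' - z)) (z' - z)) t := fun t =>
    ((hφ.differentiable (by norm_num)) _).hasFDerivAt.comp_hasDerivAt t (hline t)
  have h2 : ∀ t ∈ Set.Icc (0 : ℝ) 1,
      HasDerivAt (fun t : ℝ => fderiv ℝ φ (z + t • (z' - z)) (z' - z)) 0 t := fun t ht => by
    have h3 := (ContDiff.hasDerivAt_fderiv_line hφ (hline t)).clm_apply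
      (hasDerivAt_const t (z' - z))
    rw [h _ (hB.add_smul_sub_mem hz hz' ht)] at h3
    simpa using h3
  simpa using eq_add_of_hasDerivAt_of_hasDerivAt_zero h1 h2

end Flat

section Graph

variable {d : ℕ}


/-- `S` coincides in the open set `U` with the graph of the `C²` function `φ` over the hyperplane
orthogonal to the unit vector `n`. -/
structure IsGraphOn (S : Set (EuclideanSpace ℝ (Fin d))) (n : EuclideanSpace ℝ (Fin d)) (φ : (Submodule.span ℝ {n})ᗮ → ℝ) (U : Set (EuclideanSpace ℝ (Fin d))) : Prop where
  norm_eq : ‖n‖ = 1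
  contDiff : ContDiff ℝ 2 φ
  isOpen : IsOpen U
  mem_iff : ∀ x ∈ U, x ∈ S ↔ inner ℝ n x = φ ((Submodule.span ℝ {n})ᗮ.orthogonalProjectionOnto x)

/-- The parametrization of the graph of `φ` over the hyperplane orthogonal to `n`. -/
noncomputable def graphMap (n : EuclideanSpace ℝ (Fin d)) (φ : (Submodule.span ℝ {n})ᗮ → ℝ)
    (z : (Submodule.span ℝ {n})ᗮ) : EuclideanSpace ℝ (Fin d) := (z : EuclideanSpace ℝ (Fin d)) + φ z • n

lemma inner_orthogonal_span {n : EuclideanSpace ℝ (Fin d)} (z : (Submodule.span ℝ {n})ᗮ) : inner ℝ n (z : EuclideanSpace ℝ (Fin d)) = 0 :=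
  (Submodule.mem_orthogonal _ _).1 z.2 n (Submodule.mem_span_singleton_self n)

variable {S U : Set (EuclideanSpace ℝ (Fin d))} {n : EuclideanSpace ℝ (Fin d)} {φ : (Submodule.span ℝ {n})ᗮ → ℝ}

lemma orthogonalProjectionOnto_graphMap (z : (Submodule.span ℝ {n})ᗮ) :
    (Submodule.span ℝ {n})ᗮ.orthogonalProjectionOnto (graphMap n φ z) = z := by
  rw [graphMap, map_add, map_smul, Submodule.orthogonalProjectionOnto_orthogonalComplement_singleton_eq_zero, smul_zero, add_zero,
    Submodule.orthogonalProjectionOnto_mem_subspace_eq_self]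

lemma coe_orthogonalProjectionOnto (hn : ‖n‖ = 1) (x : EuclideanSpace ℝ (Fin d)) :
    ((Submodule.span ℝ {n})ᗮ.orthogonalProjectionOnto x : EuclideanSpace ℝ (Fin d)) = x - (inner ℝ n x : ℝ) • n := by
  rw [Submodule.orthogonalProjectionOnto_orthogonal, ← Submodule.starProjection_unit_singleton ℝ hn]

lemma graphMap_orthogonalProjectionOnto (hn : ‖n‖ = 1) {x : EuclideanSpace ℝ (Fin d)}
    (hx : inner ℝ n x = φ ((Submodule.span ℝ {n})ᗮ.orthogonalProjectionOnto x)) :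
    graphMap n φ ((Submodule.span ℝ {n})ᗮ.orthogonalProjectionOnto x) = x := by
  rw [graphMap, ← hx, coe_orthogonalProjectionOnto hn, sub_add_cancel]

lemma inner_graphMap (hn : ‖n‖ = 1) (z : (Submodule.span ℝ {n})ᗮ) :
    inner ℝ n (graphMap n φ z) = φ z := by
  rw [graphMap, inner_add_right, inner_orthogonal_span, inner_smul_right,
    real_inner_self_eq_norm_sq, hn]
  simp

namespace IsGraphOn

variable (h : IsGraphOn S n φ U)
include h

lemma graphMap_mem {z : (Submodule.span ℝ {n})ᗮ} (hz : graphMap n φ z ∈ U) :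
    graphMap n φ z ∈ S := by
  rw [h.mem_iff _ hz, inner_graphMap h.norm_eq, orthogonalProjectionOnto_graphMap]

lemma graphMap_proj {x : EuclideanSpace ℝ (Fin d)} (hx : x ∈ U) (hxS : x ∈ S) :
    graphMap n φ ((Submodule.span ℝ {n})ᗮ.orthogonalProjectionOnto x) = x :=
  graphMap_orthogonalProjectionOnto h.norm_eq ((h.mem_iff x hx).1 hxS)

lemma continuous_graphMap : Continuous (graphMap n φ) :=
  continuous_subtype_val.add (h.contDiff.continuous.smul continuous_const)

lemma exists_ball {x : EuclideanSpace ℝ (Fin d)} (hx : x ∈ U) (hxS : x ∈ S) : ∃ ε > 0, ∀ z ∈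
    Metric.ball ((Submodule.span ℝ {n})ᗮ.orthogonalProjectionOnto x) ε, graphMap n φ z ∈ U := by
  have h1 : ∀ᶠ z in 𝓝 ((Submodule.span ℝ {n})ᗮ.orthogonalProjectionOnto x),
      graphMap n φ z ∈ U := by
    apply h.continuous_graphMap.continuousAt.eventually
    rw [h.graphMap_proj hx hxS]
    exact h.isOpen.mem_nhds hx
  exact Metric.eventually_nhds_iff_ball.1 h1

end IsGraphOn

lemma IsC2Hypersurface.exists_isGraphOn (hS : IsC2Hypersurface S) {p : EuclideanSpace ℝ (Fin d)} (hp : p ∈ S) :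
    ∃ n φ U, IsGraphOn S n φ U ∧ p ∈ U := by
  obtain ⟨n, hn, φ, hφ, U, hU, hpU, h⟩ := hS p hp
  exact ⟨n, φ, U, ⟨hn, hφ, hU, h⟩, hpU⟩

section Affine

variable (h : IsGraphOn S n φ U) {B : Set (Submodule.span ℝ {n})ᗮ} (hB : ∀ z ∈ B, graphMap n φ z ∈ U)
  (haff : ∀ z ∈ B, ∀ z' ∈ B, φ z' = φ z + fderiv ℝ φ z (z' - z))
include h haff

lemma IsGraphOn.exists_hyperplane {x : EuclideanSpace ℝ (Fin d)}
    (hx : (Submodule.span ℝ {n})ᗮ.orthogonalProjectionOnto x ∈ B) :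
    ∃ v : EuclideanSpace ℝ (Fin d), v ≠ 0 ∧ ∃ a : ℝ, ∀ y ∈ S, y ∈ U →
      (Submodule.span ℝ {n})ᗮ.orthogonalProjectionOnto y ∈ B → inner ℝ v y = a := by
  obtain ⟨z₀, hz₀⟩ : ∃ z₀, z₀ = (Submodule.span ℝ {n})ᗮ.orthogonalProjectionOnto x := ⟨_, rfl⟩
  rw [← hz₀] at hx
  obtain ⟨ℓ, hℓ⟩ : ∃ ℓ : EuclideanSpace ℝ (Fin d) →L[ℝ] ℝ, ∀ y, ℓ y = inner ℝ n y -
      fderiv ℝ φ z₀ ((Submodule.span ℝ {n})ᗮ.orthogonalProjectionOnto y) :=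
    ⟨innerSL ℝ n - (fderiv ℝ φ z₀).comp (Submodule.span ℝ {n})ᗮ.orthogonalProjectionOnto,
      fun y => rfl⟩
  refine ⟨(InnerProductSpace.toDual ℝ (EuclideanSpace ℝ (Fin d))).symm ℓ, ?_,
    φ z₀ - fderiv ℝ φ z₀ z₀, ?_⟩
  · intro h0
    have h1 : ℓ n = 0 := by
      rw [← InnerProductSpace.toDual_symm_apply, h0, inner_zero_left]
    have h2 : ℓ n = 1 := by
      rw [hℓ, Submodule.orthogonalProjectionOnto_orthogonalComplement_singleton_eq_zero, map_zero,
        real_inner_self_eq_norm_sq, h.norm_eq]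
      norm_num
    linarith
  · intro y hyS hyU hyB
    have h1 := (h.mem_iff y hyU).1 hyS
    have h2 := haff _ hx _ hyB
    rw [InnerProductSpace.toDual_symm_apply, hℓ, h1, h2, map_sub]
    ring

include hB

lemma IsGraphOn.inner_eq_of_eventually (hBo : IsOpen B) {y : EuclideanSpace ℝ (Fin d)} (hyS : y ∈ S)
    (hyU : y ∈ U) (hyB : (Submodule.span ℝ {n})ᗮ.orthogonalProjectionOnto y ∈ B)
    {v : EuclideanSpace ℝ (Fin d)} {a : ℝ} (hv : ∀ᶠ z in 𝓝[S] y, inner ℝ v z = a)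
    {z : EuclideanSpace ℝ (Fin d)} (hzS : z ∈ S)
    (hzU : z ∈ U) (hzB : (Submodule.span ℝ {n})ᗮ.orthogonalProjectionOnto z ∈ B) :
    inner ℝ v z = a := by
  have hy0 : inner ℝ v y = a := hv.self_of_nhdsWithin hyS
  have hgy := h.graphMap_proj hyU hyS
  have hgz := h.graphMap_proj hzU hzS
  generalize (Submodule.span ℝ {n})ᗮ.orthogonalProjectionOnto y = y₀ at *
  generalize (Submodule.span ℝ {n})ᗮ.orthogonalProjectionOnto z = z₀ at *
  have hform : ∀ z ∈ B, inner ℝ v (graphMap n φ z) = inner ℝ v y +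
      (inner ℝ v ((z - y₀ : (Submodule.span ℝ {n})ᗮ) : EuclideanSpace ℝ (Fin d)) +
        fderiv ℝ φ y₀ (z - y₀) * inner ℝ v n) := fun z hz => by
    conv_rhs => rw [← hgy]
    simp only [graphMap]
    rw [haff _ hyB _ hz, inner_add_right, inner_smul_right, inner_add_right, inner_smul_right,
      Submodule.coe_sub, inner_sub_right]
    ring
  -- The equation holds at y₀ + t w for some small t > 0, which kills the linear part in the
  -- direction w. It then holds over all of B, where φ is affine.
  have hM0 : ∀ w : (Submodule.span ℝ {n})ᗮ, inner ℝ v (w : EuclideanSpace ℝ (Fin d)) +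
      fderiv ℝ φ y₀ w * inner ℝ v n = 0 := fun w => by
    have hcont : Continuous fun t : ℝ => y₀ + t • w := by fun_prop
    have hc : Filter.Tendsto (fun t : ℝ => graphMap n φ (y₀ + t • w)) (𝓝 0) (𝓝 y) := by
      have h0 := (h.continuous_graphMap.comp hcont).tendsto 0
      simpa [hgy, Function.comp_def] using h0
    have hb : ∀ᶠ t : ℝ in 𝓝 0, y₀ + t • w ∈ B := by
      refine hcont.continuousAt.eventually (hBo.mem_nhds ?_)
      simpa using hyB
    have he := hc.eventually (eventually_nhdsWithin_iff.1 hv)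
    obtain ⟨t, ⟨ht1, ht2⟩, ht0⟩ := ((((hb.and he).filter_mono nhdsWithin_le_nhds).and
      (self_mem_nhdsWithin : Set.Ioi (0:ℝ) ∈ 𝓝[>] 0))).exists
    have h3 := ht2 (h.graphMap_mem (hB _ ht1))
    rw [hform _ ht1, hy0, add_sub_cancel_left, map_smul, Submodule.coe_smul, inner_smul_right,
      smul_eq_mul] at h3
    refine (mul_eq_zero.1 ?_).resolve_left (ne_of_gt ht0)
    linarith
  rw [← hgz, hform _ hzB, hM0, add_zero, hy0]

end Affine

/-- Near a point where a graph is flat, the local linear equations are the same at all points. -/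
lemma IsGraphOn.exists_nhds_of_flat (h : IsGraphOn S n φ U)
    (hflat : ∀ q ∈ U, q ∈ S → ∀ e,
      fderiv ℝ (fderiv ℝ φ) ((Submodule.span ℝ {n})ᗮ.orthogonalProjectionOnto q) e e = 0)
    {x : EuclideanSpace ℝ (Fin d)} (hx : x ∈ U) (hxS : x ∈ S) :
    ∃ V : Set (EuclideanSpace ℝ (Fin d)), IsOpen V ∧ x ∈ V ∧
      (∃ v : EuclideanSpace ℝ (Fin d), v ≠ 0 ∧ ∃ a : ℝ, ∀ y ∈ V ∩ S, inner ℝ v y = a) ∧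
      ∀ y ∈ V ∩ S, ∀ v : EuclideanSpace ℝ (Fin d), ∀ a : ℝ, (∀ᶠ z in 𝓝[S] y, inner ℝ v z = a) →
        ∀ z ∈ V ∩ S, inner ℝ v z = a := by
  obtain ⟨ε, hε, hB⟩ := h.exists_ball hx hxS
  have hxB := Metric.mem_ball_self (x := (Submodule.span ℝ {n})ᗮ.orthogonalProjectionOnto x) hε
  have hD : ∀ z ∈ Metric.ball ((Submodule.span ℝ {n})ᗮ.orthogonalProjectionOnto x) ε, ∀ e,
      fderiv ℝ (fderiv ℝ φ) z e e = 0 := fun z hz e => by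
    have := hflat _ (hB z hz) (h.graphMap_mem (hB z hz)) e
    rwa [orthogonalProjectionOnto_graphMap] at this
  have haff := fun z hz z' hz' =>
    eq_add_fderiv_of_convex h.contDiff (convex_ball _ _) hD (z := z) (z' := z') hz hz'
  have hopen := Metric.isOpen_ball (x := (Submodule.span ℝ {n})ᗮ.orthogonalProjectionOnto x) (ε := ε)
  generalize Metric.ball ((Submodule.span ℝ {n})ᗮ.orthogonalProjectionOnto x) ε = B at *
  refine ⟨U ∩ (Submodule.span ℝ {n})ᗮ.orthogonalProjectionOnto ⁻¹' B, h.isOpen.inter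
    (hopen.preimage (ContinuousLinearMap.continuous _)), ⟨hx, hxB⟩, ?_, ?_⟩
  · obtain ⟨v, hv, a, ha⟩ := h.exists_hyperplane haff hxB
    exact ⟨v, hv, a, fun y hy => ha y hy.2 hy.1.1 hy.1.2⟩
  · exact fun y hy v a hva z hz =>
      h.inner_eq_of_eventually hB haff hopen hy.2 hy.1.1 hy.1.2 hva hz.2 hz.1.1 hz.1.2

/-- A `C²` hypersurface with a component outside of all hyperplanes has a point of nonzero
curvature. -/
lemma IsC2Hypersurface.exists_curved (hS : IsC2Hypersurface S)
    (hflat : ∃ p ∈ S, ¬ LiesInHyperplane (connectedComponentIn S p)) :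
    ∃ n φ U, IsGraphOn S n φ U ∧ ∃ q ∈ U, q ∈ S ∧ ∃ e,
      fderiv ℝ (fderiv ℝ φ) ((Submodule.span ℝ {n})ᗮ.orthogonalProjectionOnto q) e e ≠ 0 := by
  by_contra! hcon
  obtain ⟨p, hp, hflat⟩ := hflat
  have key : ∀ x ∈ S, ∃ V : Set (EuclideanSpace ℝ (Fin d)), IsOpen V ∧ x ∈ V ∧
      (∃ v : EuclideanSpace ℝ (Fin d), v ≠ 0 ∧ ∃ a : ℝ, ∀ y ∈ V ∩ S, inner ℝ v y = a) ∧
      ∀ y ∈ V ∩ S, ∀ v : EuclideanSpace ℝ (Fin d), ∀ a : ℝ, (∀ᶠ z in 𝓝[S] y, inner ℝ v z = a) →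
        ∀ z ∈ V ∩ S, inner ℝ v z = a := fun x hx => by
    obtain ⟨n, φ, U, h, hxU⟩ := hS.exists_isGraphOn hx
    exact h.exists_nhds_of_flat (hcon n φ U h) hxU hx
  have hsub := connectedComponentIn_subset S p
  have hpC := mem_connectedComponentIn hp
  have hmem : ∀ {V : Set (EuclideanSpace ℝ (Fin d))} {y : EuclideanSpace ℝ (Fin d)}, IsOpen V → y ∈ V → V ∩ S ∈ 𝓝[S] y := fun hV hy =>
    Filter.inter_mem (mem_nhdsWithin_of_mem_nhds (hV.mem_nhds hy)) self_mem_nhdsWithin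
  -- The relation carried along the component is that every linear equation valid on S near x is
  -- valid on S near y. It holds locally in both directions and is transitive, and it avoids
  -- comparing normals of different charts.
  have hP := fun y hy => (isPreconnected_connectedComponentIn (x := p) (F := S)).induction₂'
    (fun x y => ∀ v : EuclideanSpace ℝ (Fin d), ∀ a : ℝ, (∀ᶠ z in 𝓝[S] x, inner ℝ v z = a) →
      ∀ᶠ z in 𝓝[S] y, inner ℝ v z = a) (fun x hx => by
        obtain ⟨V, hV, hxV, -, hlin⟩ := key x (hsub hx)
        have h1 : V ∩ connectedComponentIn S p ∈ 𝓝[connectedComponentIn S p] x :=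
          Filter.inter_mem (mem_nhdsWithin_of_mem_nhds (hV.mem_nhds hxV)) self_mem_nhdsWithin
        filter_upwards [h1] with y hy
        exact ⟨fun v a hva => Filter.mem_of_superset (hmem hV hy.1)
            (hlin x ⟨hxV, hsub hx⟩ v a hva),
          fun v a hva => Filter.mem_of_superset (hmem hV hxV)
            (hlin y ⟨hy.1, hsub hy.2⟩ v a hva)⟩)
    (fun x y z _ _ _ h1 h2 v a h => h2 v a (h1 v a h)) hpC (y := y) hy
  obtain ⟨V, hV, hpV, ⟨v, hv, a, hva⟩, -⟩ := key p hp
  exact hflat ⟨v, hv, a, fun y hy =>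
    (hP y hy v a (Filter.mem_of_superset (hmem hV hpV) hva)).self_of_nhdsWithin (hsub hy)⟩

end Graph


/-! ### Surface measure of small caps -/

section SurfaceMeasure

variable {d : ℕ} {S U : Set (EuclideanSpace ℝ (Fin d))} {n : EuclideanSpace ℝ (Fin d)}
  {φ : (Submodule.span ℝ {n})ᗮ → ℝ}

lemma finrank_orthogonal_span (hn : ‖n‖ = 1) :
    Module.finrank ℝ (Submodule.span ℝ {n})ᗮ = d - 1 := by
  have h := Submodule.finrank_add_finrank_orthogonal (Submodule.span ℝ {n})
  rw [finrank_span_singleton (by rintro rfl; simp at hn), finrank_euclideanSpace_fin] at h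
  omega

lemma _root_.LipschitzOnWith.euclideanHausdorffMeasure_image_le {X Y : Type*} [MetricSpace X]
    [MetricSpace Y] [MeasurableSpace X] [BorelSpace X] [MeasurableSpace Y] [BorelSpace Y]
    {K : ℝ≥0} {f : X → Y} {s : Set X} (h : LipschitzOnWith K f s) (m : ℕ) :
    Measure.euclideanHausdorffMeasure m (f '' s) ≤
      (K : ℝ≥0∞) ^ m * Measure.euclideanHausdorffMeasure m s := by
  have h1 := h.hausdorffMeasure_image_le (d := m) m.cast_nonneg
  rw [ENNReal.rpow_natCast] at h1
  rw [Measure.euclideanHausdorffMeasure_def, Measure.euclideanHausdorffMeasure_def,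
    Measure.smul_apply, Measure.smul_apply, ENNReal.smul_def, ENNReal.smul_def, smul_eq_mul,
    smul_eq_mul, mul_left_comm]
  gcongr

lemma IsGraphOn.exists_lipschitz (h : IsGraphOn S n φ U) {q : EuclideanSpace ℝ (Fin d)}
    (hq : q ∈ U) (hqS : q ∈ S) : ∃ K : ℝ≥0, 1 ≤ K ∧ ∃ ε > 0,
      LipschitzOnWith K (graphMap n φ)
        (Metric.ball ((Submodule.span ℝ {n})ᗮ.orthogonalProjectionOnto q) ε) ∧
      ∀ z ∈ Metric.ball ((Submodule.span ℝ {n})ᗮ.orthogonalProjectionOnto q) ε,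
        graphMap n φ z ∈ U := by
  obtain ⟨ε, hε, hB⟩ := h.exists_ball hq hqS
  have hc : ContDiff ℝ 1 (graphMap n φ) :=
    ((Submodule.span ℝ {n})ᗮ.subtypeL.contDiff).add
      ((h.contDiff.of_le (by norm_num)).smul contDiff_const)
  obtain ⟨K, t, ht, hK⟩ := (hc.contDiffAt
    (x := (Submodule.span ℝ {n})ᗮ.orthogonalProjectionOnto q)).exists_lipschitzOnWith
  obtain ⟨ε', hε', hε't⟩ := Metric.mem_nhds_iff.1 ht
  exact ⟨max K 1, le_max_right _ _, min ε ε', lt_min hε hε', (hK.weaken (le_max_left _ _)).mono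
    ((Metric.ball_subset_ball (min_le_right _ _)).trans hε't),
    fun z hz => hB z (Metric.ball_subset_ball (min_le_left _ _) hz)⟩

variable {K : ℝ≥0} {ε : ℝ} {z₀ : (Submodule.span ℝ {n})ᗮ}

/-- The orthogonal projection does not increase Hausdorff measure, and the image of a cap of radius
ρ contains a ball of radius ρ / K in the hyperplane, where the measure is Haar. -/
lemma IsGraphOn.exists_surfaceMeasure_ball_ge (h : IsGraphOn S n φ U) (hK : 1 ≤ K)
    (hL : LipschitzOnWith K (graphMap n φ) (Metric.ball z₀ ε))
    (hB : ∀ z ∈ Metric.ball z₀ ε, graphMap n φ z ∈ U) :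
    ∃ c : ℝ, 0 < c ∧ ∀ z ∈ Metric.ball z₀ (ε / 2), ∀ ρ : ℝ, 0 < ρ → ρ ≤ ε / 2 →
      ENNReal.ofReal (c * ρ ^ (d - 1)) ≤ surfaceMeasure S (Metric.ball (graphMap n φ z) ρ) := by
  have hK0 : (0 : ℝ) < K := by
    have : (1 : ℝ) ≤ K := by exact_mod_cast hK
    linarith
  have hfr := finrank_orthogonal_span h.norm_eq
  set μ : Measure (Submodule.span ℝ {n})ᗮ := Measure.euclideanHausdorffMeasure (d - 1) with hμ
  have hHaar : μ.IsAddHaarMeasure := by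
    rw [hμ, ← hfr]
    infer_instance
  have hpos : 0 < μ (Metric.ball 0 1) := Metric.measure_ball_pos _ _ one_pos
  have htop : μ (Metric.ball 0 1) ≠ ∞ := measure_ball_lt_top.ne
  refine ⟨(1 / (K : ℝ)) ^ (d - 1) * (μ (Metric.ball 0 1)).toReal,
    mul_pos (by positivity) (ENNReal.toReal_pos hpos.ne' htop), fun z hz ρ hρ hρε => ?_⟩
  have hsub : Metric.ball z (ρ / K) ⊆ (Submodule.span ℝ {n})ᗮ.orthogonalProjectionOnto ''
      (Metric.ball (graphMap n φ z) ρ ∩ S) := by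
    intro y hy
    have hρK : ρ / K ≤ ρ := div_le_self hρ.le (by exact_mod_cast hK)
    rw [Metric.mem_ball] at hz hy
    have hyB : y ∈ Metric.ball z₀ ε := by
      rw [Metric.mem_ball]
      linarith [dist_triangle y z z₀]
    have hzB : z ∈ Metric.ball z₀ ε := by
      rw [Metric.mem_ball]
      linarith [dist_nonneg (x := z) (y := z₀)]
    refine ⟨graphMap n φ y, ⟨?_, h.graphMap_mem (hB y hyB)⟩, orthogonalProjectionOnto_graphMap y⟩
    rw [Metric.mem_ball]
    calc dist (graphMap n φ y) (graphMap n φ z) ≤ K * dist y z := hL.dist_le_mul y hyB z hzB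
      _ < K * (ρ / K) := by gcongr
      _ = ρ := by field_simp
  have hproj : LipschitzWith 1 ((Submodule.span ℝ {n})ᗮ.orthogonalProjectionOnto) := by
    refine LipschitzWith.of_dist_le_mul fun x y => ?_
    rw [NNReal.coe_one, one_mul, dist_eq_norm, dist_eq_norm, ← map_sub]
    exact Submodule.norm_orthogonalProjectionOnto_apply_le _ _
  have h1 := (measure_mono (μ := μ) hsub).trans
    (hproj.lipschitzOnWith.euclideanHausdorffMeasure_image_le (d - 1))
  rw [ENNReal.coe_one, one_pow, one_mul, Measure.addHaar_ball_of_pos μ z (by positivity), hfr] at h1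
  rw [surfaceMeasure, Measure.restrict_apply Metric.isOpen_ball.measurableSet]
  refine le_trans (le_of_eq ?_) h1
  rw [← ENNReal.ofReal_toReal htop, ← ENNReal.ofReal_mul (by positivity),
    ENNReal.toReal_ofReal ENNReal.toReal_nonneg]
  congr 1
  rw [div_pow, div_pow, one_pow]
  ring

lemma IsGraphOn.exists_surfaceMeasure_ball_lt_top (h : IsGraphOn S n φ U)
    {q : EuclideanSpace ℝ (Fin d)} (hq : q ∈ U)
    (hqB : (Submodule.span ℝ {n})ᗮ.orthogonalProjectionOnto q ∈ Metric.ball z₀ ε)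
    (hL : LipschitzOnWith K (graphMap n φ) (Metric.ball z₀ ε)) :
    ∃ r > 0, surfaceMeasure S (Metric.ball q r) < ∞ := by
  have hV : U ∩ (Submodule.span ℝ {n})ᗮ.orthogonalProjectionOnto ⁻¹' (Metric.ball z₀ ε) ∈ 𝓝 q :=
    (h.isOpen.inter (Metric.isOpen_ball.preimage (ContinuousLinearMap.continuous _))).mem_nhds
      ⟨hq, hqB⟩
  obtain ⟨r, hr, hrV⟩ := Metric.mem_nhds_iff.1 hV
  refine ⟨r, hr, ?_⟩
  rw [surfaceMeasure, Measure.restrict_apply Metric.isOpen_ball.measurableSet]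
  have hsub : Metric.ball q r ∩ S ⊆ graphMap n φ '' Metric.ball z₀ ε := fun x hx =>
    ⟨_, (hrV hx.1).2, h.graphMap_proj (hrV hx.1).1 hx.2⟩
  refine (measure_mono hsub).trans_lt ((hL.euclideanHausdorffMeasure_image_le (d - 1)).trans_lt ?_)
  have hHaar : (Measure.euclideanHausdorffMeasure (d - 1) :
      Measure (Submodule.span ℝ {n})ᗮ).IsAddHaarMeasure := by
    rw [← finrank_orthogonal_span h.norm_eq]
    infer_instance
  exact ENNReal.mul_lt_top (by finiteness) measure_ball_lt_top

end SurfaceMeasure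

/-! ### The curve and its adapted frame -/

section Taylor

/-- A function vanishing to first order at `0` with nonzero second derivative is comparable to a
quadratic. -/
lemma exists_quadratic_bounds {ψ ψ' : ℝ → ℝ} {κ : ℝ} (h0 : ψ 0 = 0) (h0' : ψ' 0 = 0)
    (h1 : ∀ t, HasDerivAt ψ (ψ' t) t) (h2 : HasDerivAt ψ' κ 0) (hκ : κ ≠ 0) :
    ∃ r > 0, ∀ t, 0 < t → t ≤ r → |κ| / 4 * t ^ 2 ≤ |ψ t| ∧ |ψ t| ≤ 3 * (|κ| / 4) * t ^ 2 := by
  have hκ' : 0 < |κ| := abs_pos.2 hκ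
  -- An error |κ|/4 · t² around the main term |κ|/2 · t² gives the window from 1/4 to 3/4. Only
  -- differentiability of ψ' at 0 is used, so C² regularity is enough.
  have ho := (hasDerivAt_iff_isLittleO.1 h2).def (c := |κ| / 4) (by positivity)
  obtain ⟨r, hr, hball⟩ := Metric.eventually_nhds_iff_ball.1 ho
  refine ⟨r / 2, by positivity, fun t ht htr => ?_⟩
  have hg : ∀ s, HasDerivAt (fun s => ψ s - κ / 2 * s ^ 2) (ψ' s - κ * s) s := fun s => by
    refine ((h1 s).fun_sub ((hasDerivAt_pow 2 s).const_mul (κ / 2))).congr_deriv ?_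
    norm_num
    ring
  obtain ⟨c, hc, hc'⟩ := exists_hasDerivAt_eq_slope (fun s => ψ s - κ / 2 * s ^ 2)
    (fun s => ψ' s - κ * s) ht (fun s _ => (hg s).continuousAt.continuousWithinAt) fun s _ => hg s
  have h3 := hball c (by
    rw [Metric.mem_ball, dist_zero_right, Real.norm_eq_abs, abs_of_pos hc.1]
    linarith [hc.2])
  simp only [h0', sub_zero, smul_eq_mul, Real.norm_eq_abs, abs_of_pos hc.1] at h3
  simp only [h0] at hc'
  have h4 : ψ t - κ / 2 * t ^ 2 = (ψ' c - κ * c) * t := by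
    rw [eq_div_iff (by simpa using ht.ne')] at hc'
    linarith
  have h5 : |ψ t - κ / 2 * t ^ 2| ≤ |κ| / 4 * t ^ 2 := by
    rw [h4, abs_mul, abs_of_pos ht, sq, ← mul_assoc]
    rw [mul_comm c κ] at h3
    have h6 := hc.2
    gcongr
    exact h3.trans (by gcongr)
  have h6 : |κ / 2 * t ^ 2| = |κ| / 2 * t ^ 2 := by
    rw [abs_mul, abs_div, abs_of_pos (by positivity : 0 < t ^ 2)]
    norm_num
  have h7 := abs_sub_abs_le_abs_sub (ψ t) (κ / 2 * t ^ 2)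
  have h8 := abs_sub_abs_le_abs_sub (κ / 2 * t ^ 2) (ψ t)
  rw [abs_sub_comm] at h8
  constructor <;> linarith

end Taylor


section Frame

variable {d : ℕ} {n : EuclideanSpace ℝ (Fin d)}

/-- An orthonormal basis of the hyperplane orthogonal to `n` starting with `e`, indexed by `Fin d`
with a zero vector at the index `i₁`. -/
lemma exists_frame (hn : ‖n‖ = 1) {e : (Submodule.span ℝ {n})ᗮ} (he : ‖e‖ = 1) {i₀ i₁ : Fin d}
    (hi : i₀ ≠ i₁) : ∃ c : Fin d → (Submodule.span ℝ {n})ᗮ, c i₀ = e ∧ c i₁ = 0 ∧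
      (∀ i, ‖c i‖ ≤ 1) ∧ (∀ i, i ≠ i₀ → inner ℝ e (c i) = 0) ∧
      ∀ v : EuclideanSpace ℝ (Fin d), ‖v‖ ≤ |inner ℝ n v| +
        ∑ i, |inner ℝ (c i : EuclideanSpace ℝ (Fin d)) v| := by
  classical
  -- The pair e, n is extended to an orthonormal basis of the whole space. Projecting off n then
  -- annihilates exactly the vector at i₁, leaving that slot free for the normal coordinate.
  have horth : Orthonormal ℝ (({i₀, i₁} : Set (Fin d)).domRestrict fun i =>
      if i = i₀ then (e : EuclideanSpace ℝ (Fin d)) else n) := by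
    rw [orthonormal_iff_ite]
    have h1 : ‖(e : EuclideanSpace ℝ (Fin d))‖ = 1 := he
    have h3 := inner_orthogonal_span e
    have h4 : inner ℝ (e : EuclideanSpace ℝ (Fin d)) n = (0 : ℝ) := by rw [real_inner_comm]; exact h3
    rintro ⟨i, hi'⟩ ⟨j, hj'⟩
    rcases hi' with rfl | rfl <;> rcases hj' with rfl | rfl <;>
      simp [Set.domRestrict_apply, Subtype.ext_iff, hi.symm, hi, h1, hn, h3, h4]
  obtain ⟨b, hb⟩ := horth.exists_orthonormalBasis_extension_of_card_eq (by simp)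
  have hb0 : b i₀ = e := by simpa using hb i₀ (by simp)
  have hb1 : b i₁ = n := by simpa [hi.symm] using hb i₁ (by simp)
  have hci : ∀ i, i ≠ i₁ → ((Submodule.span ℝ {n})ᗮ.orthogonalProjectionOnto (b i) :
      EuclideanSpace ℝ (Fin d)) = b i := fun i hi' => by
    rw [coe_orthogonalProjectionOnto hn, ← hb1, b.inner_eq_zero hi'.symm, zero_smul, sub_zero]
  refine ⟨fun i => (Submodule.span ℝ {n})ᗮ.orthogonalProjectionOnto (b i), ?_, ?_, fun i => ?_,
    fun i hi' => ?_, fun v => ?_⟩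
  · simp only
    rw [hb0, Submodule.orthogonalProjectionOnto_mem_subspace_eq_self]
  · simp only
    rw [hb1, Submodule.orthogonalProjectionOnto_orthogonalComplement_singleton_eq_zero]
  · exact (Submodule.norm_orthogonalProjectionOnto_apply_le _ _).trans (b.norm_eq_one i).le
  · by_cases h1 : i = i₁
    · simp only
      rw [h1, hb1, Submodule.orthogonalProjectionOnto_orthogonalComplement_singleton_eq_zero,
        inner_zero_right]
    · rw [Submodule.coe_inner, hci i h1, ← hb0, b.inner_eq_zero hi'.symm]
  · have h1 : ‖v‖ ≤ ∑ i, |inner ℝ (b i) v| := by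
      conv_lhs => rw [← b.sum_repr' v]
      refine (norm_sum_le _ _).trans (Finset.sum_le_sum fun i _ => ?_)
      rw [norm_smul, b.norm_eq_one, mul_one, Real.norm_eq_abs]
    rw [← Finset.add_sum_erase _ _ (Finset.mem_univ i₁), hb1] at h1
    refine h1.trans (add_le_add le_rfl ?_)
    calc ∑ i ∈ Finset.univ.erase i₁, |inner ℝ (b i) v|
        = ∑ i ∈ Finset.univ.erase i₁, |inner ℝ ((Submodule.span ℝ {n})ᗮ.orthogonalProjectionOnto
            (b i) : EuclideanSpace ℝ (Fin d)) v| :=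
          Finset.sum_congr rfl fun i hi' => by rw [hci i (Finset.ne_of_mem_erase hi')]
      _ ≤ _ := Finset.sum_le_sum_of_subset_of_nonneg (Finset.erase_subset _ _)
          fun _ _ _ => abs_nonneg _

end Frame

section Curve

variable {d : ℕ} {F : Type*} [NormedAddCommGroup F] [NormedSpace ℝ F]

/-- The polynomial curve with coefficients `c`. -/
noncomputable def momentCurve (c : Fin d → F) (t : ℝ) : F := ∑ i : Fin d, t ^ ((i : ℕ) + 1) • c i

lemma momentCurve_zero (c : Fin d → F) : momentCurve c 0 = 0 := by simp [momentCurve]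

lemma continuous_momentCurve (c : Fin d → F) : Continuous (momentCurve c) := by
  unfold momentCurve
  fun_prop

/-- The curve starts with velocity c i₀. The contribution of its acceleration through the first
derivative of φ cancels against the subtracted linear term, leaving second derivative κ at 0. -/
lemma exists_momentCurve_quadratic_bounds {φ : F → ℝ} (hφ : ContDiff ℝ 2 φ) (z₀ : F) (c : Fin d → F)
    {i₀ : Fin d} (hi₀ : (i₀ : ℕ) = 0) {κ : ℝ} (hκ : fderiv ℝ (fderiv ℝ φ) z₀ (c i₀) (c i₀) = κ)
    (hκ0 : κ ≠ 0) : ∃ r > 0, ∀ t, 0 < t → t ≤ r →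
      |κ| / 4 * t ^ 2 ≤ |φ (z₀ + momentCurve c t) - φ z₀ - fderiv ℝ φ z₀ (momentCurve c t)| ∧
      |φ (z₀ + momentCurve c t) - φ z₀ - fderiv ℝ φ z₀ (momentCurve c t)| ≤
        3 * (|κ| / 4) * t ^ 2 := by
  set z' : ℝ → F := fun t => ∑ i : Fin d, (((i : ℕ) + 1 : ℝ) * t ^ (i : ℕ)) • c i with hz'
  have hz : ∀ t, HasDerivAt (momentCurve c) (z' t) t := fun t => by
    refine HasDerivAt.fun_sum fun i _ => HasDerivAt.smul_const ?_ (c i)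
    simpa using hasDerivAt_pow ((i : ℕ) + 1) t
  have hz0 : z' 0 = c i₀ := by
    rw [hz']
    refine (Finset.sum_eq_single i₀ (fun i _ hi => ?_) (by simp)).trans ?_
    · have : (i : ℕ) ≠ 0 := fun h => hi (Fin.ext (h.trans hi₀.symm))
      rw [zero_pow this, mul_zero, zero_smul]
    · simp [hi₀]
  have hz'd : DifferentiableAt ℝ z' 0 := by
    rw [hz']
    fun_prop
  have hzz : ∀ t, HasDerivAt (fun t => z₀ + momentCurve c t) (z' t) t := fun t =>
    (hz t).const_add z₀
  have h1 : ∀ t, HasDerivAt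
      (fun t => φ (z₀ + momentCurve c t) - φ z₀ - fderiv ℝ φ z₀ (momentCurve c t))
      (fderiv ℝ φ (z₀ + momentCurve c t) (z' t) - fderiv ℝ φ z₀ (z' t)) t := fun t => by
    refine HasDerivAt.fun_sub (HasDerivAt.sub_const _ ?_) ?_
    · exact ((hφ.differentiable (by norm_num)) _).hasFDerivAt.comp_hasDerivAt t (hzz t)
    · exact (fderiv ℝ φ z₀).hasFDerivAt.comp_hasDerivAt t (hz t)
  have h2 : HasDerivAt (fun t => fderiv ℝ φ (z₀ + momentCurve c t) (z' t) - fderiv ℝ φ z₀ (z' t))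
      κ 0 := by
    refine (((ContDiff.hasDerivAt_fderiv_line hφ (hzz 0)).clm_apply hz'd.hasDerivAt).fun_sub
      ((fderiv ℝ φ z₀).hasFDerivAt.comp_hasDerivAt 0 hz'd.hasDerivAt)).congr_deriv ?_
    rw [momentCurve_zero, add_zero, hz0, hκ]
    ring
  exact exists_quadratic_bounds (by simp [momentCurve_zero]) (by simp [momentCurve_zero]) h1 h2 hκ0

end Curve

/-! ### Frequencies that are lacunary in every direction -/

section Frequencies

variable {d : ℕ} {n : EuclideanSpace ℝ (Fin d)} {φ : (Submodule.span ℝ {n})ᗮ → ℝ}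

/-- The coordinates of a vector in the (nonorthogonal) dual frame adapted to the tangent space. -/
noncomputable def frameCoeff (ℓ : (Submodule.span ℝ {n})ᗮ →L[ℝ] ℝ)
    (c : Fin d → (Submodule.span ℝ {n})ᗮ) (i₁ : Fin d) (v : EuclideanSpace ℝ (Fin d)) (i : Fin d) :
    ℝ :=
  if i = i₁ then inner ℝ n v
  else inner ℝ (c i : EuclideanSpace ℝ (Fin d)) v + ℓ (c i) * inner ℝ n v

/-- The linear part ℓ of the graph is absorbed into the tangential coefficients. The normal
remainder, of order t² when ℓ is the derivative at z₀, takes the slot i₁ where c vanishes; with i₁ =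
1 this is the missing power t². -/
lemma inner_graphMap_sub (z₀ : (Submodule.span ℝ {n})ᗮ) (ℓ : (Submodule.span ℝ {n})ᗮ →L[ℝ] ℝ)
    {c : Fin d → (Submodule.span ℝ {n})ᗮ} {i₁ : Fin d} (hc : c i₁ = 0) (t : ℝ)
    (v : EuclideanSpace ℝ (Fin d)) :
    inner ℝ (graphMap n φ (z₀ + momentCurve c t) - graphMap n φ z₀) v =
      ∑ i, frameCoeff ℓ c i₁ v i * (if i = i₁ then
        φ (z₀ + momentCurve c t) - φ z₀ - ℓ (momentCurve c t) else t ^ ((i : ℕ) + 1)) := by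
  have h1 : ∀ i, frameCoeff ℓ c i₁ v i * (if i = i₁ then
        φ (z₀ + momentCurve c t) - φ z₀ - ℓ (momentCurve c t) else t ^ ((i : ℕ) + 1)) =
      (t ^ ((i : ℕ) + 1) * inner ℝ (c i : EuclideanSpace ℝ (Fin d)) v +
        t ^ ((i : ℕ) + 1) * ℓ (c i) * inner ℝ n v) + if i = i₁ then
        (φ (z₀ + momentCurve c t) - φ z₀ - ℓ (momentCurve c t)) * inner ℝ n v else 0 := fun i => by
    by_cases hi : i = i₁
    · subst hi
      simp only [frameCoeff, if_true, hc, map_zero]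
      rw [Submodule.coe_zero, inner_zero_left]
      ring
    · simp only [frameCoeff, if_neg hi]
      ring
  have h2 : inner ℝ ((momentCurve c t : (Submodule.span ℝ {n})ᗮ) : EuclideanSpace ℝ (Fin d)) v =
      ∑ i : Fin d, t ^ ((i : ℕ) + 1) * inner ℝ (c i : EuclideanSpace ℝ (Fin d)) v := by
    rw [momentCurve, Submodule.coe_sum, sum_inner]
    exact Finset.sum_congr rfl fun i _ => by rw [Submodule.coe_smul, real_inner_smul_left]
  have h3 : ℓ (momentCurve c t) = ∑ i : Fin d, t ^ ((i : ℕ) + 1) * ℓ (c i) := by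
    rw [momentCurve, map_sum]
    exact Finset.sum_congr rfl fun i _ => by rw [map_smul, smul_eq_mul]
  simp_rw [h1]
  rw [Finset.sum_add_distrib, Finset.sum_add_distrib, ← Finset.sum_mul, ← h2, ← h3,
    Finset.sum_ite_eq' Finset.univ i₁, if_pos (Finset.mem_univ _)]
  simp only [graphMap, inner_sub_left, inner_add_left, real_inner_smul_left, Submodule.coe_add]
  ring

/-- If all coefficients were smaller, then so would be the normal component and, up to a factor 1 +
‖ℓ‖, the tangential ones, and ‖v‖ would be less than 1. The bound is uniform in the direction v. -/
lemma exists_frameCoeff_ge (ℓ : (Submodule.span ℝ {n})ᗮ →L[ℝ] ℝ)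
    {c : Fin d → (Submodule.span ℝ {n})ᗮ} {i₁ : Fin d} (hc : c i₁ = 0) (hc1 : ∀ i, ‖c i‖ ≤ 1)
    {v : EuclideanSpace ℝ (Fin d)} (hv : ‖v‖ = 1)
    (hcv : ‖v‖ ≤ |inner ℝ n v| + ∑ i, |inner ℝ (c i : EuclideanSpace ℝ (Fin d)) v|) :
    ∃ i, 1 / ((1 + ‖ℓ‖) * (d + 1)) ≤ |frameCoeff ℓ c i₁ v i| := by
  by_contra! hcon
  set c₀ := 1 / ((1 + ‖ℓ‖) * ((d : ℝ) + 1)) with hc₀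
  have hc₀pos : 0 < c₀ := by positivity
  have h1 : |inner ℝ n v| < c₀ := by simpa [frameCoeff] using hcon i₁
  have h2 : ∀ i, |inner ℝ (c i : EuclideanSpace ℝ (Fin d)) v| ≤ (1 + ‖ℓ‖) * c₀ := fun i => by
    by_cases hi : i = i₁
    · rw [hi, hc, Submodule.coe_zero, inner_zero_left, abs_zero]
      positivity
    · have h3 := (hcon i).le
      rw [frameCoeff, if_neg hi] at h3
      have h4 : |ℓ (c i) * inner ℝ n v| ≤ ‖ℓ‖ * c₀ := by
        rw [abs_mul]
        have : |ℓ (c i)| ≤ ‖ℓ‖ := by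
          have := ℓ.le_opNorm (c i)
          rw [Real.norm_eq_abs] at this
          exact this.trans (mul_le_of_le_one_right (norm_nonneg _) (hc1 i))
        gcongr
      have h5 := abs_sub_abs_le_abs_sub (inner ℝ (c i : EuclideanSpace ℝ (Fin d)) v)
        (-(ℓ (c i) * inner ℝ n v))
      rw [abs_neg, sub_neg_eq_add] at h5
      linarith
  have h3 : ∑ i, |inner ℝ (c i : EuclideanSpace ℝ (Fin d)) v| ≤ d * ((1 + ‖ℓ‖) * c₀) := by
    refine (Finset.sum_le_sum fun i _ => h2 i).trans (le_of_eq ?_)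
    rw [Finset.sum_const, Finset.card_univ, Fintype.card_fin, nsmul_eq_mul]
  have h4 : (1 + ‖ℓ‖) * (d + 1) * c₀ = 1 := by
    rw [hc₀]
    field_simp
  nlinarith [norm_nonneg ℓ, mul_nonneg (norm_nonneg ℓ) hc₀pos.le]

end Frequencies


section Frequencies

variable {d : ℕ} {S U : Set (EuclideanSpace ℝ (Fin d))} {n : EuclideanSpace ℝ (Fin d)}
  {φ : (Submodule.span ℝ {n})ᗮ → ℝ}

/-- Frequencies on a graph along a geometric sequence on a curve are lacunary in every direction,
up to at most `d ^ 2` exceptions. -/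
lemma exists_lacunary_graphMap (z₀ : (Submodule.span ℝ {n})ᗮ)
    (ℓ : (Submodule.span ℝ {n})ᗮ →L[ℝ] ℝ) {c : Fin d → (Submodule.span ℝ {n})ᗮ} {i₀ i₁ : Fin d}
    (hi₀ : (i₀ : ℕ) = 0) (hi₁ : (i₁ : ℕ) = 1)
    (hc₀ : ‖c i₀‖ = 1) (hc₁ : c i₁ = 0) (hc : ∀ i, ‖c i‖ ≤ 1)
    (horth : ∀ i, i ≠ i₀ → inner ℝ (c i₀) (c i) = 0)
    (hcv : ∀ v : EuclideanSpace ℝ (Fin d), ‖v‖ ≤ |inner ℝ n v| +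
        ∑ i, |inner ℝ (c i : EuclideanSpace ℝ (Fin d)) v|) {A r : ℝ} (hA : 0 < A)
    (hr : 0 < r) (hr1 : r ≤ 1) (hquad : ∀ t, 0 < t → t ≤ r →
      A * t ^ 2 ≤ |φ (z₀ + momentCurve c t) - φ z₀ - ℓ (momentCurve c t)| ∧
      |φ (z₀ + momentCurve c t) - φ z₀ - ℓ (momentCurve c t)| ≤ 3 * A * t ^ 2) :
    ∃ (t : ℕ → ℝ) (C M : ℝ), 0 < C ∧ 1 ≤ M ∧ (∀ j, 0 < t j ∧ t j ≤ r) ∧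
      (∀ (N : ℕ) (v : EuclideanSpace ℝ (Fin d)), ‖v‖ = 1 → ∃ G ⊆ Finset.range N,
        (Finset.range N \ G).card ≤ d ^ 2 ∧ ∀ a ∈ G, ∑ j ∈ G with a < j,
          |inner ℝ (graphMap n φ (z₀ + momentCurve c (t j)) - graphMap n φ z₀) v| + C * M⁻¹ ^ N ≤
          |inner ℝ (graphMap n φ (z₀ + momentCurve c (t a)) - graphMap n φ z₀) v|) ∧
      ∀ (N j k : ℕ), j < k → k < N → C * M⁻¹ ^ N ≤
        ‖graphMap n φ (z₀ + momentCurve c (t j)) - graphMap n φ (z₀ + momentCurve c (t k))‖ := by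
  have hd : 0 < d := i₀.pos
  have hd' : (1 : ℝ) ≤ d := by exact_mod_cast hd
  obtain ⟨L, hL⟩ : ∃ L : ℝ, L = 9 * (2 * d + 1) ^ 2 := ⟨_, rfl⟩
  have hL81 : 81 ≤ L := by rw [hL]; nlinarith
  have hL0 : 0 < L⁻¹ := by positivity
  have hL1 : L⁻¹ ≤ 1 := inv_le_one_of_one_le₀ (by linarith)
  have hL2 : L⁻¹ ≤ 1 / 2 := by
    rw [inv_le_comm₀ (by linarith) (by norm_num)]; linarith
  obtain ⟨t, ht⟩ : ∃ t : ℕ → ℝ, ∀ j, t j = r * L⁻¹ ^ j := ⟨_, fun _ => rfl⟩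
  have htpos : ∀ j, 0 < t j := fun j => by rw [ht]; positivity
  have htr : ∀ j, t j ≤ r := fun j => by
    rw [ht]; exact mul_le_of_le_one_right hr.le (pow_le_one₀ hL0.le hL1)
  set c₀ := 1 / ((1 + ‖ℓ‖) * ((d : ℝ) + 1)) with hc₀'
  have hc₀pos : 0 < c₀ := by positivity
  have hApos : 0 < min 1 A := lt_min one_pos hA
  -- The first entry is a quarter of the lower bound for the dominant coordinate, whose power of t
  -- is at most d; hence also M = L ^ d. The second serves the separation t j − t k ≥ t j / 2.
  set C := min (c₀ * min 1 A * r ^ d / 4) (r / 2) with hC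
  have hCpos : 0 < C := lt_min (by positivity) (by positivity)
  have hMpow : ∀ N : ℕ, ((L ^ d)⁻¹) ^ N = (L⁻¹ ^ N) ^ d := fun N => by
    rw [← inv_pow, ← pow_mul, ← pow_mul, mul_comm]
  refine ⟨t, C, L ^ d, hCpos, one_le_pow₀ (by linarith), fun j => ⟨htpos j, htr j⟩, ?_, ?_⟩
  · intro N v hv
    obtain ⟨i, hi⟩ := exists_frameCoeff_ge ℓ hc₁ hc hv (hcv v)
    set s : Fin d → ℕ → ℝ := fun i j => if i = i₁ then
      φ (z₀ + momentCurve c (t j)) - φ z₀ - ℓ (momentCurve c (t j)) else t j ^ ((i : ℕ) + 1)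
      with hs
    set B : Fin d → ℝ := fun i => if i = i₁ then A else 1 with hB
    have hBpos : ∀ i, 0 < B i := fun i => by
      simp only [hB]; split_ifs <;> linarith
    have hlow : ∀ i j, B i * (r * L⁻¹ ^ j) ^ ((i : ℕ) + 1) ≤ |s i j| := fun i j => by
      rw [← ht]
      by_cases h : i = i₁
      · simp only [hB, hs, h, hi₁]
        exact (hquad _ (htpos j) (htr j)).1
      · simp only [hB, hs, if_neg h, one_mul]
        exact le_abs_self _
    have hup : ∀ i j, |s i j| ≤ 3 * B i * (r * L⁻¹ ^ j) ^ ((i : ℕ) + 1) := fun i j => by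
      rw [← ht]
      by_cases h : i = i₁
      · simp only [hB, hs, h, hi₁]
        exact (hquad _ (htpos j) (htr j)).2
      · simp only [hB, hs, if_neg h]
        have := pow_pos (htpos j) ((i : ℕ) + 1)
        rw [abs_of_pos this]
        linarith
    have hM0 : 0 < (L ^ d)⁻¹ ^ N := by positivity
    have key := exists_lacunary_subset hr hL hBpos hlow hup (frameCoeff ℓ c i₁ v) N
      (mul_pos hCpos hM0) i (fun k hk => by
        rw [abs_mul]
        have h1 : min 1 A * (r * L⁻¹ ^ N) ^ d ≤ |s i k| := by
          refine le_trans ?_ (hlow i k)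
          have h2 : min 1 A ≤ B i := by
            simp only [hB]; split_ifs
            exacts [min_le_right _ _, min_le_left _ _]
          have h3 : r * L⁻¹ ^ N ≤ r * L⁻¹ ^ k := by
            have := pow_le_pow_of_le_one hL0.le hL1 hk.le
            gcongr
          have h4 : (r * L⁻¹ ^ k) ^ d ≤ (r * L⁻¹ ^ k) ^ ((i : ℕ) + 1) := by
            rw [← ht]
            exact pow_le_pow_of_le_one (htpos k).le ((htr k).trans hr1) i.2
          calc min 1 A * (r * L⁻¹ ^ N) ^ d ≤ B i * (r * L⁻¹ ^ k) ^ d := by gcongr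
            _ ≤ _ := mul_le_mul_of_nonneg_left h4 (hBpos i).le
        calc 4 * (C * (L ^ d)⁻¹ ^ N) ≤ 4 * ((c₀ * min 1 A * r ^ d / 4) * (L ^ d)⁻¹ ^ N) := by
              gcongr; exact min_le_left _ _
          _ = c₀ * (min 1 A * (r * L⁻¹ ^ N) ^ d) := by rw [hMpow, mul_pow]; ring
          _ ≤ _ := by gcongr)
    simp only [hs] at key
    simpa only [inner_graphMap_sub z₀ ℓ hc₁] using key
  · intro N j k hjk hkN
    have hne : i₁ ≠ i₀ := fun h => by rw [h, hi₀] at hi₁; omega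
    have h1 : ∀ t : ℝ, inner ℝ (graphMap n φ (z₀ + momentCurve c t) - graphMap n φ z₀)
        (c i₀ : EuclideanSpace ℝ (Fin d)) = t := fun t => by
      rw [inner_graphMap_sub z₀ 0 hc₁, Finset.sum_eq_single i₀]
      · rw [frameCoeff, if_neg hne.symm, if_neg hne.symm, real_inner_self_eq_norm_sq,
          ← Submodule.coe_norm, hc₀, hi₀]
        simp
      · intro i _ hi
        have h2 : frameCoeff 0 c i₁ (c i₀ : EuclideanSpace ℝ (Fin d)) i = 0 := by
          rw [frameCoeff]
          split_ifs
          · exact inner_orthogonal_span _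
          · rw [inner_orthogonal_span, mul_zero, add_zero, real_inner_comm, ← Submodule.coe_inner,
              horth i hi]
        rw [h2, zero_mul]
      · simp
    have h2 : inner ℝ (graphMap n φ (z₀ + momentCurve c (t j)) -
        graphMap n φ (z₀ + momentCurve c (t k))) (c i₀ : EuclideanSpace ℝ (Fin d)) = t j - t k := by
      rw [← h1 (t j), ← h1 (t k), ← inner_sub_left, sub_sub_sub_cancel_right, h1, h1]
    have h3 := real_inner_le_norm (graphMap n φ (z₀ + momentCurve c (t j)) -
        graphMap n φ (z₀ + momentCurve c (t k))) (c i₀ : EuclideanSpace ℝ (Fin d))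
    rw [h2, ← Submodule.coe_norm, hc₀, mul_one] at h3
    refine le_trans ?_ h3
    have h4 : t k ≤ t j / 2 := by
      have h5 : L⁻¹ ^ (k - j) ≤ L⁻¹ ^ 1 := pow_le_pow_of_le_one hL0.le hL1 (by omega)
      have h6 : t k = L⁻¹ ^ (k - j) * t j := by
        rw [ht, ht, mul_left_comm, ← pow_add, Nat.sub_add_cancel hjk.le]
      rw [h6]
      have := htpos j
      nlinarith
    have h5 : C * (L ^ d)⁻¹ ^ N ≤ t j / 2 := by
      have h7 : (L⁻¹ ^ N) ^ d ≤ L⁻¹ ^ N :=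
        pow_le_of_le_one (by positivity) (pow_le_one₀ hL0.le hL1) hd.ne'
      have h8 : L⁻¹ ^ N ≤ L⁻¹ ^ j := pow_le_pow_of_le_one hL0.le hL1 (hjk.trans hkN).le
      rw [hMpow, ht]
      calc C * (L⁻¹ ^ N) ^ d ≤ r / 2 * L⁻¹ ^ j := by
            gcongr
            · exact min_le_right _ _
            · exact h7.trans h8
        _ = _ := by ring
    linarith

/-- On a curved hypersurface there are exponentially separated points, with regular surface measure,
whose differences from a base point are lacunary in every direction up to a bounded number of
exceptions. -/
theorem IsC2Hypersurface.exists_frequencies (hd : 2 ≤ d) (hS : IsC2Hypersurface S)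
    (hflat : ∃ p ∈ S, ¬ LiesInHyperplane (connectedComponentIn S p)) :
    ∃ (q : EuclideanSpace ℝ (Fin d)) (η : ℕ → EuclideanSpace ℝ (Fin d)) (C M c ρ₀ : ℝ),
      0 < C ∧ 1 ≤ M ∧ 0 < c ∧ 0 < ρ₀ ∧
      (∀ (N : ℕ) (v : EuclideanSpace ℝ (Fin d)), ‖v‖ = 1 → ∃ G ⊆ Finset.range N,
        (Finset.range N \ G).card ≤ d ^ 2 ∧ ∀ a ∈ G, ∑ j ∈ G with a < j,
          |inner ℝ (η j) v| + C * M⁻¹ ^ N ≤ |inner ℝ (η a) v|) ∧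
      (∀ (N j k : ℕ), j < k → k < N → C * M⁻¹ ^ N ≤ ‖η j - η k‖) ∧
      (∀ (j : ℕ) (ρ : ℝ), 0 < ρ → ρ ≤ ρ₀ →
        ENNReal.ofReal (c * ρ ^ (d - 1)) ≤ surfaceMeasure S (Metric.ball (q + η j) ρ)) ∧
      surfaceMeasure S (⋃ j, Metric.ball (q + η j) ρ₀) < ∞ := by
  obtain ⟨n, φ, U, h, q, hqU, hqS, e', he'⟩ := hS.exists_curved hflat
  obtain ⟨K, hK, ε, hε, hL, hB⟩ := h.exists_lipschitz hqU hqS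
  obtain ⟨r₁, hr₁, hfin⟩ := h.exists_surfaceMeasure_ball_lt_top hqU (Metric.mem_ball_self hε) hL
  obtain ⟨c', hc', hmeas⟩ := h.exists_surfaceMeasure_ball_ge hK hL hB
  have hgq := h.graphMap_proj hqU hqS
  obtain ⟨z₀, hz₀⟩ : ∃ z₀, z₀ = (Submodule.span ℝ {n})ᗮ.orthogonalProjectionOnto q := ⟨_, rfl⟩
  rw [← hz₀] at he' hmeas hgq
  have he0 : e' ≠ 0 := by rintro rfl; simp at he'
  have he0' : 0 < ‖e'‖ := norm_pos_iff.2 he0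
  obtain ⟨e, he⟩ : ∃ e, e = ‖e'‖⁻¹ • e' := ⟨_, rfl⟩
  have henorm : ‖e‖ = 1 := by
    rw [he, norm_smul, norm_inv, norm_norm, inv_mul_cancel₀ he0'.ne']
  have hκ : fderiv ℝ (fderiv ℝ φ) z₀ e e ≠ 0 := by
    rw [he, map_smul, smul_eq_mul, map_smul, smul_apply, smul_eq_mul]
    exact mul_ne_zero (by positivity) (mul_ne_zero (by positivity) he')
  obtain ⟨c, hc₀, hc₁, hc, horth, hcv⟩ := exists_frame h.norm_eq henorm
    (i₀ := (⟨0, by omega⟩ : Fin d)) (i₁ := ⟨1, by omega⟩) (by simp)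
  obtain ⟨r, hr, hquad⟩ := exists_momentCurve_quadratic_bounds h.contDiff z₀ c
    (i₀ := (⟨0, by omega⟩ : Fin d)) rfl rfl (by rwa [hc₀])
  rw [hc₀] at hquad
  have hcurve : Continuous fun t : ℝ => z₀ + momentCurve c t :=
    continuous_const.add (continuous_momentCurve c)
  have hnear : ∀ᶠ t : ℝ in 𝓝 0, z₀ + momentCurve c t ∈ Metric.ball z₀ (ε / 2) ∧
      graphMap n φ (z₀ + momentCurve c t) ∈ Metric.ball q (r₁ / 2) := by
    refine (hcurve.continuousAt.eventually (Metric.isOpen_ball.mem_nhds ?_)).and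
      ((h.continuous_graphMap.comp hcurve).continuousAt.eventually
        (Metric.isOpen_ball.mem_nhds ?_))
    · simpa [momentCurve_zero] using hε
    · simpa [momentCurve_zero, hgq] using hr₁
  obtain ⟨r₂, hr₂, hball⟩ := Metric.eventually_nhds_iff_ball.1 hnear
  -- The radius is at most 1 so that higher powers of t are smaller, and at most r₂ / 2 so that the
  -- whole curve stays where the cap estimates hold.
  obtain ⟨t, C, M, hC, hM, ht, hlac, hsep⟩ := exists_lacunary_graphMap z₀
    (fderiv ℝ φ z₀) rfl rfl (by rw [hc₀, henorm]) hc₁ hc (by rw [hc₀]; exact horth) hcv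
    (A := |fderiv ℝ (fderiv ℝ φ) z₀ e e| / 4) (r := min (min r 1) (r₂ / 2))
    (by have := abs_pos.2 hκ; positivity) (by positivity)
    ((min_le_left _ _).trans (min_le_right _ _))
    fun t ht htr => hquad t ht (htr.trans ((min_le_left _ _).trans (min_le_left _ _)))
  have hb := fun j => hball (t j) (by
    rw [Metric.mem_ball, dist_zero_right, Real.norm_eq_abs, abs_of_pos (ht j).1]
    linarith [(ht j).2.trans (min_le_right _ _)])
  refine ⟨q, fun j => graphMap n φ (z₀ + momentCurve c (t j)) - q, C, M, c', min (ε / 2) (r₁ / 2),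
    hC, hM, hc', by positivity, ?_, ?_, ?_, ?_⟩
  · rwa [hgq] at hlac
  · intro N j k hjk hkN
    rw [sub_sub_sub_cancel_right]
    exact hsep N j k hjk hkN
  · intro j ρ hρ hρ'
    rw [add_sub_cancel]
    exact hmeas _ (hb j).1 ρ hρ (hρ'.trans (min_le_left _ _))
  · refine (measure_mono (Set.iUnion_subset fun j x hx => ?_)).trans_lt hfin
    rw [add_sub_cancel, Metric.mem_ball] at hx
    have h1 := (hb j).2
    rw [Metric.mem_ball] at *
    linarith [dist_triangle x (graphMap n φ (z₀ + momentCurve c (t j))) q,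
      min_le_right (ε / 2) (r₁ / 2)]

end Frequencies


/-! ### The weight and its X-ray transform -/

section Weight

variable {d : ℕ}

/-- The Riesz product localized to a ball. -/
noncomputable def rieszWeight (η : ℕ → EuclideanSpace ℝ (Fin d)) (J : Finset ℕ) (R : ℝ) :
    EuclideanSpace ℝ (Fin d) → ℝ≥0 :=
  (Metric.ball 0 R).indicator fun x => (rieszProduct η J x).toNNReal

variable (η : ℕ → EuclideanSpace ℝ (Fin d)) (J : Finset ℕ) {R : ℝ}

lemma measurable_rieszWeight : Measurable (rieszWeight η J R) :=
  (continuous_rieszProduct η J).measurable.real_toNNReal.indicator Metric.isOpen_ball.measurableSet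

lemma lineIntegral_rieszWeight_le {B : ℝ≥0∞} {v : EuclideanSpace ℝ (Fin d)} (hv : ‖v‖ = 1)
    (hB : ∀ x, ∫⁻ t in Set.Icc (-(2 * R)) (2 * R),
      ENNReal.ofReal (rieszProduct η J (x + t • v)) ≤ B) (x : EuclideanSpace ℝ (Fin d)) :
    lineIntegral (rieszWeight η J R) x v ≤ B := by
  rw [lineIntegral]
  by_cases h : ∃ t₀ : ℝ, x + t₀ • v ∈ Metric.ball 0 R
  · obtain ⟨t₀, ht₀⟩ := h
    -- Recentring the line at one of its points in the ball places the whole chord in |t| ≤ 2R.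
    rw [← lintegral_add_right_eq_self (fun t : ℝ => (rieszWeight η J R (x + t • v) : ℝ≥0∞)) t₀]
    refine le_trans ?_ (hB (x + t₀ • v))
    rw [← lintegral_indicator measurableSet_Icc]
    refine lintegral_mono fun t => ?_
    have hx : x + (t + t₀) • v = x + t₀ • v + t • v := by module
    simp only [hx]
    by_cases ht : x + t₀ • v + t • v ∈ Metric.ball 0 R
    · have htI : t ∈ Set.Icc (-(2 * R)) (2 * R) := by
        rw [mem_ball_zero_iff] at ht ht₀
        have h1 : ‖t • v‖ ≤ ‖x + t₀ • v + t • v‖ + ‖x + t₀ • v‖ := by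
          have := norm_sub_le (x + t₀ • v + t • v) (x + t₀ • v)
          rwa [add_sub_cancel_left] at this
        rw [norm_smul, hv, mul_one, Real.norm_eq_abs] at h1
        exact abs_le.1 (by linarith)
      rw [Set.indicator_of_mem htI, rieszWeight, Set.indicator_of_mem ht]
      exact le_rfl
    · rw [rieszWeight, Set.indicator_of_notMem ht]
      simp
  · push Not at h
    have : ∀ t : ℝ, (rieszWeight η J R (x + t • v) : ℝ≥0∞) = 0 := fun t => by
      rw [rieszWeight, Set.indicator_of_notMem (h t), ENNReal.coe_zero]
    simp [this]

lemma xraySup_rieszWeight_pos (hd : 0 < d) (hR : 0 < R) : 0 < xraySup (rieszWeight η J R) := by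
  obtain ⟨v, hv⟩ : ∃ v : EuclideanSpace ℝ (Fin d), ‖v‖ = 1 :=
    ⟨EuclideanSpace.single ⟨0, hd⟩ 1, by simp⟩
  have hpos : 0 < lineIntegral (rieszWeight η J R) 0 v := by
    rw [lineIntegral, lintegral_pos_iff_support (by
      have := measurable_rieszWeight η J (R := R)
      fun_prop)]
    have hc : Continuous fun t : ℝ => (0 : EuclideanSpace ℝ (Fin d)) + t • v := by fun_prop
    have hopen : IsOpen {t : ℝ | (0 : EuclideanSpace ℝ (Fin d)) + t • v ∈ Metric.ball 0 R ∧
        0 < rieszProduct η J ((0 : EuclideanSpace ℝ (Fin d)) + t • v)} :=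
      (Metric.isOpen_ball.preimage hc).inter
        (isOpen_lt continuous_const ((continuous_rieszProduct η J).comp hc))
    refine (hopen.measure_pos volume ⟨0, ?_⟩).trans_le (measure_mono fun t ht => ?_)
    · simp [hR, rieszProduct_zero]
    · rw [Function.mem_support, rieszWeight, Set.indicator_of_mem ht.1]
      simpa using ht.2
  exact hpos.trans_le (le_iSup_of_le 0 (le_iSup_of_le v (le_iSup_of_le hv le_rfl)))

end Weight

/-! ### Indicators of caps, choice of parameters and conclusion -/

section Indicator

variable {d : ℕ} (S : Set (EuclideanSpace ℝ (Fin d))) {T : Set (EuclideanSpace ℝ (Fin d))}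

lemma normSqL2_indicator (hT : MeasurableSet T) :
    normSqL2 S (T.indicator 1) = surfaceMeasure S T := by
  have h : ∀ ξ, ‖T.indicator (1 : EuclideanSpace ℝ (Fin d) → ℂ) ξ‖ₑ ^ 2 =
      T.indicator (1 : EuclideanSpace ℝ (Fin d) → ℝ≥0∞) ξ := fun ξ => by
    by_cases hξ : ξ ∈ T <;> simp [hξ]
  simp_rw [normSqL2, h]
  rw [lintegral_indicator_one hT]

lemma extension_indicator (hT : MeasurableSet T) (x : EuclideanSpace ℝ (Fin d)) :
    extension S (T.indicator 1) x = ∫ ξ, Complex.exp (-2 * Real.pi * Complex.I * (inner ℝ x ξ : ℝ))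
      ∂((surfaceMeasure S).restrict T) := by
  rw [extension, ← integral_indicator hT]
  congr 1
  ext ξ
  by_cases hξ : ξ ∈ T <;> simp [hξ]

end Indicator

section Assembly

variable {d : ℕ} (S : Set (EuclideanSpace ℝ (Fin d)))

lemma surfaceMeasure_iUnion_ball_ge (q : EuclideanSpace ℝ (Fin d))
    (η : ℕ → EuclideanSpace ℝ (Fin d)) (N : ℕ) {ρ m : ℝ}
    (hsep : ∀ j k, j < k → k < N → 2 * ρ ≤ ‖η j - η k‖)
    (hm : ∀ j, ENNReal.ofReal m ≤ surfaceMeasure S (Metric.ball (q + η j) ρ)) :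
    ENNReal.ofReal (N * m) ≤
      surfaceMeasure S (⋃ j ∈ Finset.range N, Metric.ball (q + η j) ρ) := by
  have hlt : ∀ j k, j < k → k < N → Disjoint (Metric.ball (q + η j) ρ) (Metric.ball (q + η k) ρ) := by
    intro j k hjk hk
    apply Metric.ball_disjoint_ball
    rw [dist_eq_norm, add_sub_add_left_eq_sub]
    linarith [hsep j k hjk hk]
  rw [measure_biUnion_finset (fun j hj k hk hjk => ?_) fun _ _ => Metric.isOpen_ball.measurableSet]
  · calc ENNReal.ofReal (N * m) = ∑ _j ∈ Finset.range N, ENNReal.ofReal m := by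
          rw [Finset.sum_const, Finset.card_range, nsmul_eq_mul, ENNReal.ofReal_mul (by positivity),
            ENNReal.ofReal_natCast]
      _ ≤ _ := Finset.sum_le_sum fun j _ => hm j
  · rcases lt_or_gt_of_ne hjk with h | h
    · exact hlt j k h (by simpa using hk)
    · exact (hlt k j h (by simpa using hj)).symm

/-- The basic inequality for the indicator of small caps and the Riesz weight. -/
lemma exists_counterexample (hd : 2 ≤ d) (q : EuclideanSpace ℝ (Fin d))
    (η : ℕ → EuclideanSpace ℝ (Fin d)) {N : ℕ} (hN : 0 < N) {c ρ₁ R CX : ℝ} (hc : 0 < c)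
    (hρ₁ : 0 < ρ₁) (hρ₁6 : ρ₁ ≤ 1 / 6) (hR : 0 < R) (hCX : 0 < CX)
    (hsep : ∀ j k, j < k → k < N → 2 * (ρ₁ / R) ≤ ‖η j - η k‖)
    (hm : ∀ j, ENNReal.ofReal (c * (ρ₁ / R) ^ (d - 1)) ≤
      surfaceMeasure S (Metric.ball (q + η j) (ρ₁ / R)))
    (hfin : surfaceMeasure S (⋃ j ∈ Finset.range N, Metric.ball (q + η j) (ρ₁ / R)) < ∞)
    (hX : ∀ v : EuclideanSpace ℝ (Fin d), ‖v‖ = 1 → ∀ x, ∫⁻ t in Set.Icc (-(2 * R)) (2 * R),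
      ENNReal.ofReal (rieszProduct η (Finset.range N) (x + t • v)) ≤ ENNReal.ofReal (CX * R)) :
    ∃ (f : EuclideanSpace ℝ (Fin d) → ℂ) (w : EuclideanSpace ℝ (Fin d) → ℝ≥0),
      Integrable f (surfaceMeasure S) ∧ MemLp f 2 (surfaceMeasure S) ∧ 0 < normSqL2 S f ∧
      Measurable w ∧ 0 < xraySup w ∧ xraySup w < ∞ ∧
      ENNReal.ofReal ((volume (Metric.ball (0 : EuclideanSpace ℝ (Fin d)) 1)).toReal * c *
        ρ₁ ^ (d - 1) / (16 * 2 ^ d * CX) * N) * normSqL2 S f * xraySup w ≤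
        ∫⁻ x in Metric.ball (0 : EuclideanSpace ℝ (Fin d)) R,
          ‖extension S f x‖ₑ ^ 2 * (w x : ℝ≥0∞) := by
  set T := ⋃ j ∈ Finset.range N, Metric.ball (q + η j) (ρ₁ / R) with hT
  set V := (volume (Metric.ball (0 : EuclideanSpace ℝ (Fin d)) 1)).toReal with hV
  have hTm : MeasurableSet T := (isOpen_biUnion fun _ _ => Metric.isOpen_ball).measurableSet
  have hge := surfaceMeasure_iUnion_ball_ge S q η N hsep hm
  rw [← hT] at hge
  have hρpos : 0 < ρ₁ / R := by positivity
  have hTpos : 0 < surfaceMeasure S T := lt_of_lt_of_le (by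
    rw [ENNReal.ofReal_pos]
    positivity) hge
  have hXle : xraySup (rieszWeight η (Finset.range N) R) ≤ ENNReal.ofReal (CX * R) :=
    iSup_le fun x => iSup_le fun v => iSup_le fun hv =>
      lineIntegral_rieszWeight_le η _ hv (hX v hv) x
  refine ⟨T.indicator 1, rieszWeight η (Finset.range N) R, ?_, ?_, ?_, measurable_rieszWeight _ _,
    xraySup_rieszWeight_pos _ _ (by omega) hR, hXle.trans_lt ENNReal.ofReal_lt_top, ?_⟩
  · exact (integrable_indicator_iff hTm).2 (integrableOn_const hfin.ne)
  · exact memLp_indicator_const 2 hTm 1 (Or.inr hfin.ne)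
  · rwa [normSqL2_indicator S hTm]
  have hfinite : IsFiniteMeasure ((surfaceMeasure S).restrict T) :=
    ⟨by rwa [Measure.restrict_apply_univ]⟩
  have hlow := lintegral_norm_sq_exp_mul_rieszProduct_ge ((surfaceMeasure S).restrict T) η
    (Finset.range N) q (ρ := ρ₁ / R) hR (by rw [div_mul_cancel₀ _ hR.ne']; exact hρ₁6) (by
      rw [ae_restrict_iff' hTm]
      refine ae_of_all _ fun ξ hξ => ?_
      obtain ⟨j, hj, hξj⟩ := Set.mem_iUnion₂.1 hξ
      rw [mem_ball_iff_norm] at hξj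
      exact ⟨j, hj, hξj.le⟩)
  have hint : ∫⁻ x in Metric.ball (0 : EuclideanSpace ℝ (Fin d)) R,
      ‖extension S (T.indicator 1) x‖ₑ ^ 2 * (rieszWeight η (Finset.range N) R x : ℝ≥0∞) =
    ∫⁻ x in Metric.ball (0 : EuclideanSpace ℝ (Fin d)) R,
      ‖∫ ξ, Complex.exp (-2 * Real.pi * Complex.I * (inner ℝ x ξ : ℝ))
        ∂((surfaceMeasure S).restrict T)‖ₑ ^ 2 *
        ENNReal.ofReal (rieszProduct η (Finset.range N) x) := by
    refine setLIntegral_congr_fun Metric.isOpen_ball.measurableSet fun x hx => ?_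
    simp only [extension_indicator S hTm, rieszWeight, Set.indicator_of_mem hx]
    rfl
  rw [hint, normSqL2_indicator S hTm]
  refine le_trans ?_ hlow
  rw [Measure.restrict_apply_univ, Measure.addHaar_ball_of_pos _ _ (by positivity),
    finrank_euclideanSpace_fin, ← ENNReal.ofReal_toReal (measure_ball_lt_top (μ := volume)
      (x := (0 : EuclideanSpace ℝ (Fin d))) (r := 1)).ne, ← hV]
  have hV0 : 0 ≤ V := ENNReal.toReal_nonneg
  calc ENNReal.ofReal (V * c * ρ₁ ^ (d - 1) / (16 * 2 ^ d * CX) * N) * surfaceMeasure S T *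
        xraySup (rieszWeight η (Finset.range N) R)
      ≤ ENNReal.ofReal (V * c * ρ₁ ^ (d - 1) / (16 * 2 ^ d * CX) * N) * surfaceMeasure S T *
        ENNReal.ofReal (CX * R) := by gcongr
    _ = ENNReal.ofReal (V * c * ρ₁ ^ (d - 1) / (16 * 2 ^ d * CX) * N * (CX * R)) *
        surfaceMeasure S T := by
        rw [ENNReal.ofReal_mul (p := V * c * ρ₁ ^ (d - 1) / (16 * 2 ^ d * CX) * N) (by positivity)]
        ring
    _ = ENNReal.ofReal (1 / 16 * ((R / 2) ^ d * V) * (N * (c * (ρ₁ / R) ^ (d - 1)))) *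
        surfaceMeasure S T := by
        congr 2
        obtain ⟨e, rfl⟩ : ∃ e, d = e + 1 := ⟨d - 1, by omega⟩
        rw [Nat.add_sub_cancel, div_pow, div_pow]
        field_simp
        ring
    _ = ENNReal.ofReal (1 / 16) * (ENNReal.ofReal ((R / 2) ^ d) * ENNReal.ofReal V) *
        ENNReal.ofReal (N * (c * (ρ₁ / R) ^ (d - 1))) * surfaceMeasure S T := by
        rw [ENNReal.ofReal_mul (by positivity), ENNReal.ofReal_mul (by positivity),
          ENNReal.ofReal_mul (p := (R / 2) ^ d) (by positivity)]
    _ ≤ ENNReal.ofReal (1 / 16) * (ENNReal.ofReal ((R / 2) ^ d) * ENNReal.ofReal V) *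
        surfaceMeasure S T * surfaceMeasure S T := by gcongr
    _ = _ := by ring

/-- This is the source of the condition N ≤ Rδ: the Gaussian gain at x = Rδ beats the 2^N terms of
the expansion. -/
lemma two_pow_mul_exp_le_one {N : ℕ} {x : ℝ} (hx : (N : ℝ) ≤ x) :
    2 ^ N * Real.exp (-(Real.pi * x ^ 2)) ≤ 1 := by
  have h1 : (N : ℝ) ≤ Real.pi * x ^ 2 := by
    have h3 := Real.pi_gt_three
    have hNN : (N : ℝ) ≤ (N : ℝ) ^ 2 := by
      rcases Nat.eq_zero_or_pos N with rfl | h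
      · simp
      · have : (1 : ℝ) ≤ N := by exact_mod_cast h
        nlinarith
    have : (N : ℝ) ^ 2 ≤ x ^ 2 := by gcongr
    nlinarith
  calc 2 ^ N * Real.exp (-(Real.pi * x ^ 2)) ≤ (Real.exp 1) ^ N * Real.exp (-(N : ℝ)) := by
        have h2 : (2 : ℝ) ≤ Real.exp 1 := by linarith [Real.add_one_le_exp (1 : ℝ)]
        gcongr
    _ = 1 := by rw [← Real.exp_nat_mul, mul_one, ← Real.exp_add, add_neg_cancel, Real.exp_zero]

/-- A number of frequencies comparable to `log R`. -/
lemma exists_num_frequencies {C M : ℝ} (hC : 0 < C) (hM : 1 ≤ M) :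
    ∃ c : ℝ, 0 < c ∧ ∀ R : ℝ, 1 ≤ R → ∃ N : ℕ, 0 < N ∧ c * Real.log R ≤ N ∧
      (N = 1 ∨ (N : ℝ) ≤ R * (C * M⁻¹ ^ N)) := by
  have hlog : 0 < Real.log (2 * M) := Real.log_pos (by linarith)
  have hden : 0 < 2 * Real.log (2 * M) + |Real.log C| := by positivity
  refine ⟨(2 * Real.log (2 * M) + |Real.log C|)⁻¹, by positivity, fun R hR => ?_⟩
  have hR0 : 0 < R := by linarith
  -- For n ≥ 1 this gives (2M)^n ≤ RC, and then n ≤ 2^n ≤ R C M^{-n}. For small R a single frequency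
  -- is used instead.
  set n := ⌊Real.log (R * C) / Real.log (2 * M)⌋₊ with hn
  refine ⟨max 1 n, by positivity, ?_, ?_⟩
  · have h1 : (1 : ℝ) ≤ (max 1 n : ℕ) := by exact_mod_cast le_max_left 1 n
    have h2 : (n : ℝ) ≤ (max 1 n : ℕ) := by exact_mod_cast le_max_right 1 n
    have h3 := Nat.lt_floor_add_one (Real.log (R * C) / Real.log (2 * M))
    rw [← hn, div_lt_iff₀ hlog, Real.log_mul hR0.ne' hC.ne'] at h3
    rw [inv_mul_le_iff₀ hden]
    nlinarith [neg_abs_le (Real.log C), abs_nonneg (Real.log C)]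
  · rcases Nat.eq_zero_or_pos n with h0 | h0
    · left; simp [h0]
    · right
      have hmax : max 1 n = n := max_eq_right h0
      rw [hmax]
      have hnle : (n : ℝ) ≤ Real.log (R * C) / Real.log (2 * M) := by
        apply Nat.floor_le
        by_contra! hneg
        rw [hn, Nat.floor_of_nonpos hneg.le] at h0
        exact lt_irrefl _ h0
      rw [le_div_iff₀ hlog, ← Real.log_pow, Real.log_le_log_iff (by positivity) (by positivity),
        mul_pow] at hnle
      have h2 : (n : ℝ) ≤ 2 ^ n := by exact_mod_cast n.lt_two_pow_self.le
      rw [inv_pow, ← mul_assoc, ← div_eq_mul_inv, le_div_iff₀ (by positivity)]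
      refine le_trans ?_ hnle
      gcongr

lemma xraySupNormal_le_xraySup (w : EuclideanSpace ℝ (Fin d) → ℝ≥0)
    (ξ : EuclideanSpace ℝ (Fin d)) : xraySupNormal S w ξ ≤ xraySup w :=
  iSup_mono fun _ => iSup_mono fun _ => iSup_le fun hv => le_iSup_of_le hv.1 le_rfl

theorem IsC2Hypersurface.exists_log_lower_bound {S : Set (EuclideanSpace ℝ (Fin d))} (hd : 2 ≤ d)
    (hS : IsC2Hypersurface S) (hflat : ∃ p ∈ S, ¬ LiesInHyperplane (connectedComponentIn S p)) :
    ∃ c : ℝ, 0 < c ∧ ∀ R : ℝ, 1 ≤ R →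
      ∃ (f : EuclideanSpace ℝ (Fin d) → ℂ) (w : EuclideanSpace ℝ (Fin d) → ℝ≥0),
        Integrable f (surfaceMeasure S) ∧ MemLp f 2 (surfaceMeasure S) ∧ 0 < normSqL2 S f ∧
        Measurable w ∧ 0 < xraySup w ∧ xraySup w < ∞ ∧
        ENNReal.ofReal (c * Real.log R) * normSqL2 S f * xraySup w ≤
          ∫⁻ x in Metric.ball (0 : EuclideanSpace ℝ (Fin d)) R,
            ‖extension S f x‖ₑ ^ 2 * (w x : ℝ≥0∞) := by
  obtain ⟨q, η, C, M, c, ρ₀, hC, hM, hc, hρ₀, hlac, hsep, hmeas, hfin⟩ :=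
    hS.exists_frequencies hd hflat
  obtain ⟨c₂, hc₂, hnum⟩ := exists_num_frequencies hC hM
  set V := (volume (Metric.ball (0 : EuclideanSpace ℝ (Fin d)) 1)).toReal with hV
  have hVpos : 0 < V := ENNReal.toReal_pos (Metric.measure_ball_pos _ _ one_pos).ne'
    measure_ball_lt_top.ne
  set CX : ℝ := 2 ^ (d ^ 2 + 1) * Real.exp (4 * Real.pi) with hCX
  -- The bound 1/6 keeps the phases below π/3 in the lower bound. It also makes the caps disjoint,
  -- since 2ρ₁ ≤ 1 ≤ N ≤ R C M^{-N} when N > 1.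
  set ρ₁ := min ρ₀ (1 / 6) with hρ₁
  have hρ₁pos : 0 < ρ₁ := by positivity
  have hCXpos : 0 < CX := by positivity
  set c₁ := V * c * ρ₁ ^ (d - 1) / (16 * 2 ^ d * CX) with hc₁
  have hc₁pos : 0 < c₁ := by positivity
  refine ⟨c₁ * c₂, by positivity, fun R hR => ?_⟩
  have hR0 : 0 < R := by linarith
  obtain ⟨N, hN, hNlog, hNR⟩ := hnum R hR
  have hρR : ρ₁ / R ≤ ρ₀ := (div_le_self hρ₁pos.le hR).trans (min_le_left _ _)
  obtain ⟨f, w, h1, h2, h3, h4, h5, h6, h7⟩ := exists_counterexample S hd q η hN hc hρ₁pos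
    (min_le_right _ _) hR0 hCXpos (fun j k hjk hk => by
      rcases hNR with rfl | hNR
      · omega
      · refine le_trans ?_ (hsep N j k hjk hk)
        have h1N : (1 : ℝ) ≤ N := by exact_mod_cast hN
        rw [← mul_div_assoc, div_le_iff₀ hR0]
        linarith [min_le_right ρ₀ (1 / 6)])
    (fun j => hmeas j _ (by positivity) hρR)
    ((measure_mono (Set.iUnion₂_subset fun j _ => (Metric.ball_subset_ball hρR).trans
      (Set.subset_iUnion (fun j => Metric.ball (q + η j) ρ₀) j))).trans_lt hfin)
    (fun v hv x => by
      -- A single frequency may lack the required gap. It is counted as exceptional, with G empty,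
      -- which d ^ 2 ≥ 1 allows.
      rcases hNR with rfl | hNR
      · refine lintegral_rieszProduct_le η (Finset.empty_subset _) hR0 (δ := R⁻¹) (by positivity)
          (m := d ^ 2) ?_ v (by simp) ?_ x
        · simpa using Nat.one_le_pow _ _ (by omega)
        · rw [Finset.card_range, mul_assoc, ← mul_pow, mul_inv_cancel₀ hR0.ne']
          exact two_pow_mul_exp_le_one (by simp)
      · obtain ⟨G, hG, hGcard, hGlac⟩ := hlac N v hv
        refine lintegral_rieszProduct_le η hG hR0 (δ := C * M⁻¹ ^ N) (by positivity) hGcard v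
          hGlac ?_ x
        rw [Finset.card_range, mul_assoc, ← mul_pow]
        exact two_pow_mul_exp_le_one hNR)
  refine ⟨f, w, h1, h2, h3, h4, h5, h6, le_trans ?_ h7⟩
  gcongr ENNReal.ofReal ?_ * _ * _
  rw [mul_assoc c₁]
  exact mul_le_mul_of_nonneg_left hNlog hc₁pos.le

theorem IsC2Hypersurface.not_mizohataTakeuchiConjecture {S : Set (EuclideanSpace ℝ (Fin d))}
    (hd : 2 ≤ d) (hS : IsC2Hypersurface S)
    (hflat : ∃ p ∈ S, ¬ LiesInHyperplane (connectedComponentIn S p)) :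
    ¬ MizohataTakeuchiConjecture S := by
  rintro ⟨K, hK⟩
  obtain ⟨c, hc, h⟩ := hS.exists_log_lower_bound hd hflat
  -- With this R the factor c log R equals K + 1, and the positive finite norms cancel.
  obtain ⟨f, w, h1, h2, h3, h4, h5, h6, h7⟩ := h (Real.exp ((K + 1) / c))
    (Real.one_le_exp (by positivity))
  have h8 := (h7.trans (setLIntegral_le_lintegral _ _)).trans (hK f w h1 h2 h4)
  have h9 : normSqL2 S f < ∞ := by
    have := lintegral_rpow_enorm_lt_top_of_eLpNorm_lt_top (by norm_num) (by norm_num) h2.2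
    simpa [normSqL2] using this
  rw [Real.log_exp, mul_div_cancel₀ _ hc.ne', ENNReal.mul_le_mul_iff_left h5.ne' h6.ne,
    ENNReal.mul_le_mul_iff_left h3.ne' h9.ne, ← ENNReal.ofReal_coe_nnreal] at h8
  linarith [(ENNReal.ofReal_le_ofReal_iff K.coe_nonneg).1 h8]

lemma SteinConjecture.mizohataTakeuchiConjecture {S : Set (EuclideanSpace ℝ (Fin d))}
    (h : SteinConjecture S) : MizohataTakeuchiConjecture S := by
  obtain ⟨K, hK⟩ := h
  refine ⟨K, fun f w hf hf2 hw => (hK f w hf hf2 hw).trans ?_⟩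
  rw [mul_assoc]
  gcongr
  -- Only a finite supremum can be pulled out of the integral directly. If it is infinite, either f
  -- vanishes almost everywhere and 0 · ∞ = 0, or the right side is infinite.
  by_cases hX : xraySup w = ∞
  · by_cases hf0 : normSqL2 S f = 0
    · have h0 : ∀ᵐ ξ ∂(surfaceMeasure S), ‖f ξ‖ₑ ^ 2 = 0 :=
        (lintegral_eq_zero_iff' (hf.aestronglyMeasurable.enorm.pow_const 2)).1 hf0
      rw [lintegral_congr_ae (g := fun _ => 0) (by
        filter_upwards [h0] with ξ hξ
        rw [hξ, zero_mul])]
      simp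
    · rw [hX, ENNReal.mul_top hf0]
      exact le_top
  · rw [normSqL2, ← lintegral_mul_const' _ _ hX]
    exact lintegral_mono fun ξ => by
      gcongr
      exact xraySupNormal_le_xraySup S w ξ

end Assembly

end MizohataTakeuchi

theorem theorem1p1 (d : ℕ) (hd : 2 ≤ d) (S : Set (EuclideanSpace ℝ (Fin d)))
    (hS : MizohataTakeuchi.IsC2Hypersurface S)
    (hflat : ∃ p ∈ S, ¬ MizohataTakeuchi.LiesInHyperplane (connectedComponentIn S p)) :
    (∃ c : ℝ, 0 < c ∧ ∀ R : ℝ, 1 ≤ R →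
      ∃ (f : EuclideanSpace ℝ (Fin d) → ℂ) (w : EuclideanSpace ℝ (Fin d) → ℝ≥0),
        Integrable f (MizohataTakeuchi.surfaceMeasure S) ∧
        MemLp f 2 (MizohataTakeuchi.surfaceMeasure S) ∧
        0 < MizohataTakeuchi.normSqL2 S f ∧
        Measurable w ∧
        0 < MizohataTakeuchi.xraySup w ∧ MizohataTakeuchi.xraySup w < ∞ ∧
        ENNReal.ofReal (c * Real.log R) * MizohataTakeuchi.normSqL2 S f
            * MizohataTakeuchi.xraySup w ≤
          ∫⁻ x in Metric.ball (0 : EuclideanSpace ℝ (Fin d)) R,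
            ‖MizohataTakeuchi.extension S f x‖ₑ ^ 2 * (w x : ℝ≥0∞)) ∧
    ¬ MizohataTakeuchi.MizohataTakeuchiConjecture S ∧
    ¬ MizohataTakeuchi.SteinConjecture S :=
  ⟨hS.exists_log_lower_bound hd hflat, hS.not_mizohataTakeuchiConjecture hd hflat,
    fun h => hS.not_mizohataTakeuchiConjecture hd hflat h.mizohataTakeuchiConjecture⟩
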